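/- Let $\alpha\in(1,2)$ and let $\nu$ be a probability law on $[1,\infty)$ with a density $f(x)=\alpha x^{-\alpha-1}(1+o(1))$ as $x\to\infty$; let $\mu=\int x\,\nu(dx)$. For each $n$ let $W_1,\dots,W_n$ be i.i.d. with law $\nu$, and, conditionally on the weights, let the edges $\{i,j\}$ of a random graph on $[n]$ be present independently with probabilities $p_{ij}=\Theta\big(\min(W_iW_j/(\mu n),1)\big)$, where $p_{ij}$ is a measurable function of the weights and the constants in $\Theta$ are deterministic and uniform in $i\ne j$ and in the weights, for all large $n$. Let $H=([k],E_H)$ be a fixed graph on $k$ vertices, let $N(H)$ be the number of subgraphs of the random graph that are isomorphic to $H$, and let $C^{(n)}(H)=\mathbb E[N(H)\mid W_1,\dots,W_n]$. Suppose that the problem $$B(H)=\max_{\beta\in[0,1]^k}\ \sum_{i\in[k]}(1-\alpha\beta_i)+\sum_{\{i,j\}\in E_H}\min(\beta_i+\beta_j-1,0)$$ has an optimal solution in $[0,1/\alpha)^k$, and let $\gamma>k(2-\alpha)/2$. Consider $$R(H)=\max_{\beta\in[0,1]^k}\ \sum_{i\in[k]}\min(1-\alpha\beta_i,0)\quad\text{subject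 to}\quad \sum_{i\in[k]}\max(1-\alpha\beta_i,0)+\sum_{\{i,j\}\in E_H}\min(\beta_i+\beta_j-1,0)\ \ge\ \gamma ,$$ and assume that the constraint is feasible. Then: 1. for every $\varepsilon>0$, $\mathbb P(C^{(n)}(H)>n^\gamma)\le n^{R(H)+\varepsilon}$ for all large $n$; 2. if replacing "$\ge\gamma$" by "$>\gamma$" in the constraint does not change the optimal value (that is, for every $\varepsilon>0$ some $\beta\in[0,1]^k$ satisfies the strict constraint and has objective value larger than $R(H)-\varepsilon$), then $\mathbb P(C^{(n)}(H)>n^\gamma)>0$ for all large $n$ and $$\lim_{n\to\infty}\frac{\log \mathbb P(C^{(n)}(H)>n^\gamma)}{\log n}=R(H).$$ -/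

import Mathlib

open MeasureTheory ProbabilityTheory Filter Topology

namespace SubgraphDeviation

/-! ### The random graph -/

/-- `ν` is the law of a vertex weight: it lives on `[1, ∞)` and has a density `f` with respect to
Lebesgue measure such that `f x = α x ^ (-α - 1) (1 + o(1))` as `x → ∞`. -/
structure IsPowerLaw (α : ℝ) (ν : Measure ℝ) : Prop where
  isProbabilityMeasure : IsProbabilityMeasure ν
  one_le : ∀ᵐ x ∂ν, 1 ≤ x
  density : ∃ f : ℝ → ℝ, Measurable f ∧ (∀ x, 0 ≤ f x) ∧
    ν = volume.withDensity (fun x => ENNReal.ofReal (f x)) ∧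
    Tendsto (fun x => f x / (α * x ^ (-α - 1))) atTop (𝓝 1)

/-- The kernel `min (w i * w j / (μ n)) 1`, where `μ` is the mean of the weight law `ν`. -/
noncomputable def rankOneKernel (ν : Measure ℝ) (n : ℕ) (w : Fin n → ℝ) (i j : Fin n) : ℝ :=
  min (w i * w j / ((∫ x, x ∂ν) * n)) 1

/-- `p n e w` is the conditional probability of the edge `e` in the graph on `n` vertices, given
that the vector of weights is `w`. It is required to be
`Θ (min (w i * w j / (μ n)) 1)` for `e = {i, j}`, uniformly in the weights and in the pair. -/
structure IsConnectionProbability (ν : Measure ℝ)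
    (p : ∀ n : ℕ, Sym2 (Fin n) → (Fin n → ℝ) → ℝ) : Prop where
  measurable : ∀ n e, Measurable (p n e)
  mem_unitInterval : ∀ n e w, (∀ i, 1 ≤ w i) → p n e w ∈ Set.Icc (0 : ℝ) 1
  theta : ∃ c C : ℝ, 0 < c ∧ 0 < C ∧ ∀ᶠ n : ℕ in atTop, ∀ w : Fin n → ℝ, (∀ i, 1 ≤ w i) →
    ∀ i j : Fin n, i ≠ j →
      c * rankOneKernel ν n w i j ≤ p n s(i, j) w ∧ p n s(i, j) w ≤ C * rankOneKernel ν n w i j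

/-- The σ-algebra generated by the weights of all vertices. -/
abbrev weightSigma {n : ℕ} {Ω : Type*} (W : Fin n → Ω → ℝ) : MeasurableSpace Ω :=
  MeasurableSpace.comap (fun ω i => W i ω) inferInstance

/-- `G` is the inhomogeneous random graph on `n` vertices with vertex weights `W i`:
the weights are i.i.d. with law `ν` and, conditionally on the weights, the edges are present
independently of each other, the edge `e` with probability `p e W`. Conditional independence,
together with the values of the edge probabilities, is expressed by saying that any finite set `S`
of edges is present with conditional probability `∏ e ∈ S, p e W`. -/
structure IsInhomogeneousRandomGraph {n : ℕ} {Ω : Type*} [MeasurableSpace Ω] (P : Measure Ω)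
    (ν : Measure ℝ) (p : Sym2 (Fin n) → (Fin n → ℝ) → ℝ)
    (W : Fin n → Ω → ℝ) (G : Ω → SimpleGraph (Fin n)) : Prop where
  measurable_weight : ∀ i, Measurable (W i)
  law_weight : ∀ i, P.map (W i) = ν
  indep_weight : iIndepFun W P
  measurableSet_adj : ∀ i j, MeasurableSet {ω | (G ω).Adj i j}
  edges : ∀ S : Finset (Sym2 (Fin n)), (∀ e ∈ S, ¬ e.IsDiag) →
    P[Set.indicator {ω | ∀ e ∈ S, e ∈ (G ω).edgeSet} (fun _ => (1 : ℝ)) | weightSigma W]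
      =ᵐ[P] fun ω => ∏ e ∈ S, p e (fun i => W i ω)

/-- `C⁽ⁿ⁾(H)`: the conditional expectation, given all the weights, of the number of subgraphs of
`G` that are isomorphic to `H`. -/
noncomputable def condCopyCount {k n : ℕ} (H : SimpleGraph (Fin k)) {Ω : Type*}
    [MeasurableSpace Ω] (P : Measure Ω) (W : Fin n → Ω → ℝ) (G : Ω → SimpleGraph (Fin n)) :
    Ω → ℝ :=
  P[fun ω => ((G ω).copyCount H : ℝ) | weightSigma W]

/-! ### The optimization problems -/

open Classical in
/-- `∑_{{i, j} ∈ E_H} min (β i + β j - 1) 0`; each edge is listed once, with `i < j`. -/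
noncomputable def edgeExponent {k : ℕ} (H : SimpleGraph (Fin k)) (β : Fin k → ℝ) : ℝ :=
  ∑ e : Fin k × Fin k with e.1 < e.2 ∧ H.Adj e.1 e.2, min (β e.1 + β e.2 - 1) 0

/-- The objective function of `B(H)`. -/
noncomputable def expectationExponent {k : ℕ} (H : SimpleGraph (Fin k)) (α : ℝ)
    (β : Fin k → ℝ) : ℝ :=
  ∑ i, (1 - α * β i) + edgeExponent H β

/-- The problem `B(H)`, of maximizing `expectationExponent H α` over `[0, 1] ^ k`, has an optimal
solution in `[0, 1/α) ^ k`. -/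
def OptimizerHasNoHubs {k : ℕ} (H : SimpleGraph (Fin k)) (α : ℝ) : Prop :=
  ∃ β ∈ Set.Icc (0 : Fin k → ℝ) 1,
    IsMaxOn (expectationExponent H α) (Set.Icc 0 1) β ∧ ∀ i, β i < 1 / α

/-- The objective function of `R(H)`. -/
noncomputable def hubExponent {k : ℕ} (α : ℝ) (β : Fin k → ℝ) : ℝ :=
  ∑ i, min (1 - α * β i) 0

/-- The left-hand side of the constraint of `R(H)`. -/
noncomputable def copyExponent {k : ℕ} (H : SimpleGraph (Fin k)) (α : ℝ) (β : Fin k → ℝ) : ℝ :=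
  ∑ i, max (1 - α * β i) 0 + edgeExponent H β

/-- The feasible set of the problem `R(H)`. -/
def feasibleSet {k : ℕ} (H : SimpleGraph (Fin k)) (α γ : ℝ) : Set (Fin k → ℝ) :=
  {β | β ∈ Set.Icc 0 1 ∧ γ ≤ copyExponent H α β}

/-- The feasible set of the problem `R(H)` with strict inequality in the constraint. -/
def strictFeasibleSet {k : ℕ} (H : SimpleGraph (Fin k)) (α γ : ℝ) : Set (Fin k → ℝ) :=
  {β | β ∈ Set.Icc 0 1 ∧ γ < copyExponent H α β}

/-- `R(H)`, the maximum of `hubExponent α` over the feasible set; see `isGreatest_rate`. -/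
noncomputable def rate {k : ℕ} (H : SimpleGraph (Fin k)) (α γ : ℝ) : ℝ :=
  sSup (hubExponent α '' feasibleSet H α γ)

/-- If the constraint is feasible, then the maximum is attained. -/
theorem isGreatest_rate {k : ℕ} (H : SimpleGraph (Fin k)) (α γ : ℝ)
    (h : (feasibleSet H α γ).Nonempty) :
    IsGreatest (hubExponent α '' feasibleSet H α γ) (rate H α γ) := by
  have hc : Continuous (copyExponent H α) := by
    unfold copyExponent edgeExponent; fun_prop
  have ho : Continuous (hubExponent (k := k) α) := by
    unfold hubExponent; fun_prop
  have hK : IsCompact (feasibleSet H α γ) :=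
    isCompact_Icc.inter_right (isClosed_le continuous_const hc)
  exact (hK.image ho).isGreatest_sSup (h.image _)

end SubgraphDeviation

/-! Up to the factor `k ^ k`, `condCopyCount` is a deterministic function of the weights: the sum
over embeddings of the vertices of `H` of products of edge probabilities (`condCopyCount_le`,
`expectedLabelledCount_le`). Write weights as powers `n ^ b`. The expected number of vertices of
weight at least `n ^ b` is of order `n ^ (1 - α * b)`. If `1 - α * b ≥ 0`, this is also the typical
order, and exceeding it by a power of `n` is less likely than any prescribed power of `n`. If `1 - α
* b < 0`, such a vertex is a hub: having one costs probability `n ^ (1 - α * b)`. So an exponent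
vector `β` contributes about `n ^ copyExponent` copies at price `n ^ hubExponent`, and `rate` is the
exponent of the cheapest `β` that yields `n ^ γ` copies.

Upper bound: rounding exponents to a finite grid makes a union bound possible. Many copies force
either an atypical count (`measureReal_le_exceedances_le`) or hubs at a nearly feasible grid vector
(`exists_grid_of_lt_expectedLabelledCount`, `measureReal_exists_hubs_le`). Compactness
(`exists_hubExponent_lt_of_relaxed`) removes the rounding error.

Lower bound: for a strictly feasible `β`, the vertices are split into `k` independent blocks, and
the `i`-th is asked for enough weights above `n ^ β i` (`prod_le_measureReal_lt_exceedances`). One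
vertex from each block then gives an embedding (`le_expectedLabelledCount`), and the strict
inequality absorbs all constants. -/

namespace SubgraphDeviation

/-! ### Tails of the weight law -/

/-- Beyond some point, the density of a power law is within a factor two of `α x ^ (-α - 1)`. -/
theorem IsPowerLaw.exists_density_bounds {α : ℝ} {ν : Measure ℝ} (hα : 0 < α)
    (hν : IsPowerLaw α ν) :
    ∃ f : ℝ → ℝ, Measurable f ∧ (∀ x, 0 ≤ f x) ∧
      ν = volume.withDensity (fun x => ENNReal.ofReal (f x)) ∧
      ∃ a : ℝ, 1 ≤ a ∧ ∀ x, a ≤ x →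
        α / 2 * x ^ (-α - 1) ≤ f x ∧ f x ≤ 2 * α * x ^ (-α - 1) := by
  obtain ⟨f, hfm, hf0, hfν, hlim⟩ := hν.density
  refine ⟨f, hfm, hf0, hfν, ?_⟩
  have h1 : ∀ᶠ x in atTop, (1 / 2 : ℝ) < f x / (α * x ^ (-α - 1)) :=
    hlim.eventually_const_lt (by norm_num)
  have h2 : ∀ᶠ x in atTop, f x / (α * x ^ (-α - 1)) < 2 :=
    hlim.eventually_lt_const (by norm_num)
  obtain ⟨a, ha⟩ := eventually_atTop.1 ((h1.and h2).and (eventually_ge_atTop 1))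
  refine ⟨max a 1, le_max_right _ _, fun x hx => ?_⟩
  obtain ⟨⟨h3, h4⟩, h5⟩ := ha x ((le_max_left _ _).trans hx)
  have hpos : 0 < α * x ^ (-α - 1) := by positivity
  rw [lt_div_iff₀ hpos] at h3
  rw [div_lt_iff₀ hpos] at h4
  constructor <;> linarith

theorem withDensity_real_Ici {f : ℝ → ℝ} (hf : ∀ x, 0 ≤ f x) (x : ℝ)
    (hi : IntegrableOn f (Set.Ici x)) :
    (volume.withDensity fun x => ENNReal.ofReal (f x)).real (Set.Ici x) =
      ∫ t in Set.Ioi x, f t := by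
  rw [measureReal_def, withDensity_apply _ measurableSet_Ici, ← integral_Ici_eq_integral_Ioi,
    integral_eq_lintegral_of_nonneg_ae (Eventually.of_forall hf) hi.aestronglyMeasurable]

theorem integral_Ioi_rpow_neg_sub_one {α x : ℝ} (hα : 0 < α) (hx : 0 < x) :
    ∫ t in Set.Ioi x, t ^ (-α - 1) = x ^ (-α) / α := by
  rw [integral_Ioi_rpow_of_lt (by linarith) hx]
  rw [show -α - 1 + 1 = -α by ring, neg_div_neg_eq]

/-- The tail of a power law is comparable to `x ^ (-α)` on all of `[1, ∞)`. -/
theorem IsPowerLaw.exists_tail_bounds {α : ℝ} {ν : Measure ℝ} (hα : 0 < α)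
    (hν : IsPowerLaw α ν) :
    ∃ c C : ℝ, 0 < c ∧ 0 < C ∧ ∀ x : ℝ, 1 ≤ x →
      c * x ^ (-α) ≤ ν.real (Set.Ici x) ∧ ν.real (Set.Ici x) ≤ C * x ^ (-α) := by
  have := hν.isProbabilityMeasure
  obtain ⟨f, hfm, hf0, hfν, a, ha1, ha⟩ := hν.exists_density_bounds hα
  have ha0 : 0 < a := by linarith
  have hint : Integrable f := by
    refine ⟨hfm.aestronglyMeasurable, ?_⟩
    rw [hasFiniteIntegral_iff_ofReal (Eventually.of_forall hf0)]
    have h1 : ν Set.univ = 1 := measure_univ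
    rw [hfν, withDensity_apply _ MeasurableSet.univ, Measure.restrict_univ] at h1
    rw [h1]
    exact ENNReal.one_lt_top
  have key : ∀ x, a ≤ x → 1 / 2 * x ^ (-α) ≤ ν.real (Set.Ici x) ∧
      ν.real (Set.Ici x) ≤ 2 * x ^ (-α) := by
    intro x hx
    have hx0 : 0 < x := by linarith
    have hri : IntegrableOn (fun t : ℝ => t ^ (-α - 1)) (Set.Ioi x) :=
      integrableOn_Ioi_rpow_of_lt (by linarith) hx0
    rw [hfν, withDensity_real_Ici hf0 x hint.integrableOn]
    have hI := integral_Ioi_rpow_neg_sub_one hα hx0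
    constructor
    · calc 1 / 2 * x ^ (-α) = ∫ t in Set.Ioi x, α / 2 * t ^ (-α - 1) := by
            rw [integral_const_mul, hI]; field_simp
        _ ≤ ∫ t in Set.Ioi x, f t :=
            setIntegral_mono_on (hri.const_mul _) hint.integrableOn measurableSet_Ioi
              fun t ht => (ha t (hx.trans (le_of_lt ht))).1
    · calc ∫ t in Set.Ioi x, f t ≤ ∫ t in Set.Ioi x, 2 * α * t ^ (-α - 1) :=
            setIntegral_mono_on hint.integrableOn (hri.const_mul _) measurableSet_Ioi
              fun t ht => (ha t (hx.trans (le_of_lt ht))).2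
        _ = 2 * x ^ (-α) := by rw [integral_const_mul, hI]; field_simp
  -- On `[1, a]` the density is not controlled, but the tail lies between its value at `a` and 1,
  -- while `x ^ (-α)` lies between `a ^ (-α)` and 1.
  refine ⟨1 / 2 * a ^ (-α), max 2 (a ^ α), by positivity, by positivity, fun x hx => ?_⟩
  have hx0 : 0 < x := by linarith
  have hpx : 0 < x ^ (-α) := by positivity
  have hx1 : x ^ (-α) ≤ 1 := Real.rpow_le_one_of_one_le_of_nonpos hx (by linarith)
  have ha1' : a ^ (-α) ≤ 1 := Real.rpow_le_one_of_one_le_of_nonpos ha1 (by linarith)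
  have hpa : 0 < a ^ (-α) := by positivity
  rcases le_total a x with h | h
  · obtain ⟨h1, h2⟩ := key x h
    constructor
    · nlinarith
    · exact h2.trans (by gcongr; exact le_max_left _ _)
  · constructor
    · calc 1 / 2 * a ^ (-α) * x ^ (-α) ≤ 1 / 2 * a ^ (-α) * 1 := by gcongr
        _ = 1 / 2 * a ^ (-α) := mul_one _
        _ ≤ ν.real (Set.Ici a) := (key a le_rfl).1
        _ ≤ ν.real (Set.Ici x) := measureReal_mono (Set.Ici_subset_Ici.2 h)
    · calc ν.real (Set.Ici x) ≤ 1 := measureReal_le_one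
        _ = a ^ α * a ^ (-α) := by rw [← Real.rpow_add ha0]; simp
        _ ≤ a ^ α * x ^ (-α) := by
            gcongr ?_ * ?_
            exact Real.rpow_le_rpow_of_nonpos hx0 h (by linarith)
        _ ≤ max 2 (a ^ α) * x ^ (-α) := by gcongr; exact le_max_right _ _

/-- A power law with exponent larger than one has a finite mean. -/
theorem IsPowerLaw.integrable_id {α : ℝ} {ν : Measure ℝ} (hα : 1 < α) (hν : IsPowerLaw α ν) :
    Integrable (fun x => x) ν := by
  have := hν.isProbabilityMeasure
  have h1 := hν.one_le
  obtain ⟨f, hfm, hf0, hfν, a, ha1, ha⟩ := hν.exists_density_bounds (by linarith)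
  -- This function vanishes where the density is not controlled, and it differs from `x` by at most
  -- the constant `a` on `[1, ∞)`.
  have hint : Integrable (fun x => (max 0 (x - a))) ν := by
    rw [hfν, integrable_withDensity_iff (by fun_prop) (by simp)]
    have hr : IntegrableOn (fun t : ℝ => 2 * α * t ^ (-α)) (Set.Ioi a) :=
      (integrableOn_Ioi_rpow_of_lt (by linarith) (by linarith)).const_mul _
    have hr' := hr.integrable_indicator measurableSet_Ioi
    refine hr'.mono' (by fun_prop) (Eventually.of_forall fun x => ?_)
    rw [ENNReal.toReal_ofReal (hf0 x), Real.norm_of_nonneg (mul_nonneg (le_max_left _ _) (hf0 x))]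
    by_cases hx : a < x
    · have hx0 : 0 < x := by linarith
      rw [Set.indicator_of_mem (by exact hx), max_eq_right (by linarith)]
      calc (x - a) * f x ≤ x * (2 * α * x ^ (-α - 1)) :=
            mul_le_mul (by linarith) (ha x hx.le).2 (hf0 x) hx0.le
        _ = 2 * α * x ^ (-α) := by
            rw [Real.rpow_sub_one hx0.ne']; field_simp
    · rw [Set.indicator_of_notMem (by exact hx), max_eq_left (by linarith [not_lt.1 hx]), zero_mul]
  refine (hint.add (integrable_const a)).mono' (by fun_prop) ?_
  filter_upwards [h1] with x hx
  rw [Real.norm_of_nonneg (by linarith), Pi.add_apply]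
  linarith [le_max_right 0 (x - a)]

theorem IsPowerLaw.one_le_mean {α : ℝ} {ν : Measure ℝ} (hα : 1 < α) (hν : IsPowerLaw α ν) :
    1 ≤ ∫ x, x ∂ν := by
  have := hν.isProbabilityMeasure
  calc (1 : ℝ) = ∫ _, (1 : ℝ) ∂ν := by simp
    _ ≤ ∫ x, x ∂ν := integral_mono_ae (integrable_const _) (hν.integrable_id hα) hν.one_le

/-! ### Copies and embeddings -/

theorem labelledCopyCount_eq_natCard {k : ℕ} {V : Type*} [Fintype V] (G : SimpleGraph V)
    (H : SimpleGraph (Fin k)) : G.labelledCopyCount H = Nat.card (H.Copy G) := by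
  classical
  rw [SimpleGraph.labelledCopyCount]
  exact Fintype.card_eq_nat_card

/-- Each subgraph isomorphic to `H` comes from at most `k ^ k` labelled copies of `H`. -/
theorem labelledCopyCount_le_mul_copyCount {k : ℕ} {V : Type*} [Fintype V] (G : SimpleGraph V)
    (H : SimpleGraph (Fin k)) : G.labelledCopyCount H ≤ k ^ k * G.copyCount H := by
  classical
  rw [SimpleGraph.copyCount_eq_card_image_copyToSubgraph, labelledCopyCount_eq_natCard,
    Nat.card_eq_fintype_card, ← Finset.card_univ]
  refine Finset.card_le_mul_card_image _ _ fun G' hG' => ?_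
  obtain ⟨f₀, -, rfl⟩ := Finset.mem_image.1 hG'
  -- Copies with the same subgraph have the same vertex set, so each is `f₀` composed with a
  -- self-map of `Fin k`; this map determines the copy.
  have hex : ∀ f ∈ Finset.univ.filter fun f : H.Copy G => f.toSubgraph = f₀.toSubgraph,
      ∃ g : Fin k → Fin k, ∀ i, f i = f₀ (g i) := by
    intro f hf
    have hv := congrArg SimpleGraph.Subgraph.verts (Finset.mem_filter.1 hf).2
    simp only [SimpleGraph.Copy.toSubgraph, SimpleGraph.Subgraph.map_verts,
      SimpleGraph.Subgraph.verts_top, Set.image_univ] at hv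
    have : ∀ i, ∃ j, f i = f₀ j := fun i => by
      have : f i ∈ Set.range f₀.toHom := hv ▸ ⟨i, rfl⟩
      obtain ⟨j, hj⟩ := this
      exact ⟨j, hj.symm⟩
    exact ⟨fun i => (this i).choose, fun i => (this i).choose_spec⟩
  have : Nonempty (Fin k → Fin k) := ⟨id⟩
  choose! g hg using hex
  calc _ ≤ (Finset.univ : Finset (Fin k → Fin k)).card := by
        refine Finset.card_le_card_of_injOn g (by simp) fun f hf f' hf' h => ?_
        ext i
        rw [hg f hf, hg f' hf', h]
    _ = k ^ k := by simp

open Classical in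
/-- The pairs `(i, j)` with `i < j` and `{i, j}` an edge of `H`. -/
noncomputable def orderedEdges {k : ℕ} (H : SimpleGraph (Fin k)) : Finset (Fin k × Fin k) :=
  {e : Fin k × Fin k | e.1 < e.2 ∧ H.Adj e.1 e.2}

theorem mem_orderedEdges {k : ℕ} {H : SimpleGraph (Fin k)} {e : Fin k × Fin k} :
    e ∈ orderedEdges H ↔ e.1 < e.2 ∧ H.Adj e.1 e.2 := by
  simp [orderedEdges]

/-- The images of the edges of `H` under an injection of its vertices. -/
noncomputable def imageEdges {k n : ℕ} (H : SimpleGraph (Fin k)) (v : Fin k ↪ Fin n) :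
    Finset (Sym2 (Fin n)) :=
  (orderedEdges H).image fun e => s(v e.1, v e.2)

theorem not_isDiag_of_mem_imageEdges {k n : ℕ} {H : SimpleGraph (Fin k)} {v : Fin k ↪ Fin n}
    {e : Sym2 (Fin n)} (he : e ∈ imageEdges H v) : ¬ e.IsDiag := by
  obtain ⟨⟨i, j⟩, hij, rfl⟩ := Finset.mem_image.1 he
  simpa using (mem_orderedEdges.1 hij).1.ne

/-- The ordering `i < j` makes the map from ordered edges to unordered image pairs injective, so no
factor is lost. -/
theorem prod_imageEdges {k n : ℕ} (H : SimpleGraph (Fin k)) (v : Fin k ↪ Fin n)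
    (q : Sym2 (Fin n) → ℝ) :
    ∏ e ∈ imageEdges H v, q e = ∏ e ∈ orderedEdges H, q s(v e.1, v e.2) := by
  refine Finset.prod_image ?_
  rintro ⟨i, j⟩ hij ⟨i', j'⟩ hij' h
  have h1 := (mem_orderedEdges.1 hij).1
  have h2 := (mem_orderedEdges.1 hij').1
  simp only [Sym2.eq_iff, EmbeddingLike.apply_eq_iff_eq] at h
  rcases h with ⟨rfl, rfl⟩ | ⟨rfl, rfl⟩
  · rfl
  · exact absurd h1 h2.not_gt

-- Puts the count in the form of a sum of the indicators to which the field `edges` applies.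
open Classical in
theorem labelledCopyCount_eq_card {k n : ℕ} (G : SimpleGraph (Fin n)) (H : SimpleGraph (Fin k)) :
    G.labelledCopyCount H =
      (Finset.univ.filter fun v : Fin k ↪ Fin n => ∀ e ∈ imageEdges H v, e ∈ G.edgeSet).card := by
  rw [labelledCopyCount_eq_natCard, ← Fintype.card_subtype, ← Nat.card_eq_fintype_card]
  have adj : ∀ v : {v : Fin k ↪ Fin n // ∀ e ∈ imageEdges H v, e ∈ G.edgeSet}, ∀ a b,
      H.Adj a b → G.Adj (v.1 a) (v.1 b) := by
    rintro ⟨v, hv⟩ a b hab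
    have key : ∀ a b, a < b → H.Adj a b → G.Adj (v a) (v b) := fun a b hlt hab =>
      hv s(v a, v b) (Finset.mem_image.2 ⟨(a, b), mem_orderedEdges.2 ⟨hlt, hab⟩, rfl⟩)
    rcases lt_or_gt_of_ne hab.ne with h | h
    · exact key a b h hab
    · exact (key b a h hab.symm).symm
  refine Nat.card_congr
    { toFun := fun f => ⟨f.toEmbedding, fun e he => ?_⟩
      invFun := fun v => ⟨⟨v.1, fun {a b} hab => adj v a b hab⟩, v.1.injective⟩
      left_inv := fun f => rfl
      right_inv := fun v => rfl }
  obtain ⟨⟨i, j⟩, hij, rfl⟩ := Finset.mem_image.1 he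
  exact f.toHom.map_adj (mem_orderedEdges.1 hij).2

/-! ### The conditional expectation of the number of copies -/

/-- The expected number of labelled copies of `H`, as a function of the edge probabilities. -/
noncomputable def expectedLabelledCount {k n : ℕ} (H : SimpleGraph (Fin k))
    (q : Sym2 (Fin n) → ℝ) : ℝ :=
  ∑ v : Fin k ↪ Fin n, ∏ e ∈ orderedEdges H, q s(v e.1, v e.2)

namespace IsInhomogeneousRandomGraph

variable {n : ℕ} {Ω : Type*} [MeasurableSpace Ω] {P : Measure Ω} {ν : Measure ℝ}
  {p : Sym2 (Fin n) → (Fin n → ℝ) → ℝ} {W : Fin n → Ω → ℝ} {G : Ω → SimpleGraph (Fin n)}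

/-- `G` takes finitely many values, and each fibre is a finite intersection of adjacency events and
their complements. -/
theorem measurable_comp (hG : IsInhomogeneousRandomGraph P ν p W G)
    (F : SimpleGraph (Fin n) → ℝ) : Measurable fun ω => F (G ω) := by
  let _ : MeasurableSpace (SimpleGraph (Fin n)) := ⊤
  have : Measurable G := by
    refine measurable_to_countable' fun g => ?_
    have : G ⁻¹' {g} = ⋂ i, ⋂ j, {ω | (G ω).Adj i j ↔ g.Adj i j} := by
      ext ω
      simp [SimpleGraph.ext_iff, funext_iff]
    rw [this]
    refine MeasurableSet.iInter fun i => MeasurableSet.iInter fun j => ?_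
    by_cases h : g.Adj i j
    · simpa [h] using hG.measurableSet_adj i j
    · have : {ω | (G ω).Adj i j ↔ g.Adj i j} = {ω | (G ω).Adj i j}ᶜ := by
        ext ω
        simp [h]
      rw [this]
      exact (hG.measurableSet_adj i j).compl
  exact (measurable_from_top (f := F)).comp this

theorem integrable_comp [IsProbabilityMeasure P] (hG : IsInhomogeneousRandomGraph P ν p W G)
    (F : SimpleGraph (Fin n) → ℝ) : Integrable (fun ω => F (G ω)) P := by
  obtain ⟨C, hC⟩ := (Set.finite_range fun g => ‖F g‖).bddAbove
  exact Integrable.of_bound (hG.measurable_comp F).aestronglyMeasurable C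
    (Eventually.of_forall fun ω => hC ⟨G ω, rfl⟩)

theorem measurableSet_edges (hG : IsInhomogeneousRandomGraph P ν p W G)
    (S : Finset (Sym2 (Fin n))) : MeasurableSet {ω | ∀ e ∈ S, e ∈ (G ω).edgeSet} := by
  classical
  have := hG.measurable_comp (fun g => if ∀ e ∈ S, e ∈ g.edgeSet then 1 else 0)
    (measurableSet_singleton 1)
  convert this using 1
  ext ω
  by_cases h : ∀ e ∈ S, e ∈ (G ω).edgeSet <;> simp [h]

/-- The randomness of the edges is averaged out here; only the weights remain random from now on. -/
theorem condExp_labelledCopyCount [IsProbabilityMeasure P] {k : ℕ} (H : SimpleGraph (Fin k))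
    (hG : IsInhomogeneousRandomGraph P ν p W G) :
    P[fun ω => ((G ω).labelledCopyCount H : ℝ) | weightSigma W] =ᵐ[P]
      fun ω => expectedLabelledCount H fun e => p e fun i => W i ω := by
  classical
  have hsum : (fun ω => ((G ω).labelledCopyCount H : ℝ)) =
      ∑ v : Fin k ↪ Fin n, Set.indicator {ω | ∀ e ∈ imageEdges H v, e ∈ (G ω).edgeSet}
        (fun _ => (1 : ℝ)) := by
    ext ω
    rw [labelledCopyCount_eq_card, Finset.sum_apply, Finset.card_filter]
    push_cast
    refine Finset.sum_congr rfl fun v _ => ?_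
    simp only [Set.indicator_apply, Set.mem_ofPred_eq]
  rw [hsum]
  refine (condExp_finsetSum (fun v _ =>
    (integrable_const (1 : ℝ)).indicator (hG.measurableSet_edges _)) _).trans ?_
  have h : ∀ᵐ ω ∂P, ∀ v : Fin k ↪ Fin n,
      P[Set.indicator {ω | ∀ e ∈ imageEdges H v, e ∈ (G ω).edgeSet}
        (fun _ => (1 : ℝ)) | weightSigma W] ω = ∏ e ∈ imageEdges H v, p e fun i => W i ω :=
    ae_all_iff.2 fun v => hG.edges _ fun e he => not_isDiag_of_mem_imageEdges he
  filter_upwards [h] with ω hω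
  rw [Finset.sum_apply, expectedLabelledCount]
  exact Finset.sum_congr rfl fun v _ => by rw [hω v, prod_imageEdges H v fun e => p e _]

theorem condCopyCount_le [IsProbabilityMeasure P] {k : ℕ} (H : SimpleGraph (Fin k))
    (hG : IsInhomogeneousRandomGraph P ν p W G) :
    ∀ᵐ ω ∂P, condCopyCount H P W G ω ≤ expectedLabelledCount H fun e => p e fun i => W i ω := by
  have h := condExp_mono (m := weightSigma W)
    (hG.integrable_comp fun g => (g.copyCount H : ℝ))
    (hG.integrable_comp fun g => (g.labelledCopyCount H : ℝ))
    (Eventually.of_forall fun ω => Nat.cast_le.2 SimpleGraph.copyCount_le_labelledCopyCount)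
  filter_upwards [h, hG.condExp_labelledCopyCount H] with ω h1 h2
  exact h1.trans_eq h2

theorem expectedLabelledCount_le [IsProbabilityMeasure P] {k : ℕ} (H : SimpleGraph (Fin k))
    (hG : IsInhomogeneousRandomGraph P ν p W G) :
    ∀ᵐ ω ∂P, (expectedLabelledCount H fun e => p e fun i => W i ω) ≤
      (k : ℝ) ^ k * condCopyCount H P W G ω := by
  have h := condExp_mono (m := weightSigma W)
    (hG.integrable_comp fun g => (g.labelledCopyCount H : ℝ))
    (hG.integrable_comp fun g => ((k : ℝ) ^ k * g.copyCount H : ℝ))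
    (Eventually.of_forall fun ω => by
      dsimp only
      exact_mod_cast labelledCopyCount_le_mul_copyCount (G ω) H)
  have h' := condExp_smul (μ := P) ((k : ℝ) ^ k) (fun ω => ((G ω).copyCount H : ℝ)) (weightSigma W)
  filter_upwards [h, h', hG.condExp_labelledCopyCount H] with ω h1 h2 h3
  rw [← h3]
  exact h1.trans_eq h2

theorem ae_one_le {α : ℝ} (hν : IsPowerLaw α ν) (hG : IsInhomogeneousRandomGraph P ν p W G) :
    ∀ᵐ ω ∂P, ∀ i, 1 ≤ W i ω := by
  refine ae_all_iff.2 fun i => ?_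
  have h := hν.one_le
  rw [← hG.law_weight i] at h
  exact ae_of_ae_map (hG.measurable_weight i).aemeasurable h

end IsInhomogeneousRandomGraph

/-! ### Exceedances of independent variables -/

/-- The number of indices `u` with `x ≤ w u`. -/
noncomputable def exceedances {ι : Type*} (x : ℝ) (w : ι → ℝ) : ℕ :=
  Nat.card {u // x ≤ w u}

theorem exceedances_eq_sum {ι : Type*} [Fintype ι] (x : ℝ) (w : ι → ℝ) :
    (exceedances x w : ℝ) = ∑ u, Set.indicator (Set.Ici x) (fun _ => (1 : ℝ)) (w u) := by
  classical
  simp [exceedances, Fintype.card_subtype, Set.indicator_apply]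

theorem measurable_exceedances {ι : Type*} [Fintype ι] (x : ℝ) :
    Measurable fun w : ι → ℝ => (exceedances x w : ℝ) := by
  simp only [exceedances_eq_sum]
  exact Finset.measurable_sum _ fun u _ =>
    (measurable_const.indicator measurableSet_Ici).comp (measurable_pi_apply u)

section Independent

variable {ι Ω : Type*} [MeasurableSpace Ω] {P : Measure Ω} {ν : Measure ℝ} {W : ι → Ω → ℝ}

theorem measureReal_forall_le {κ : Type*} [Fintype κ] (hm : ∀ i, Measurable (W i))
    (hl : ∀ i, P.map (W i) = ν) (hi : iIndepFun W P) (v : κ ↪ ι) (x : κ → ℝ) :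
    P.real {ω | ∀ i, x i ≤ W (v i) ω} = ∏ i, ν.real (Set.Ici (x i)) := by
  have h1 : {ω | ∀ i, x i ≤ W (v i) ω} = ⋂ i ∈ Finset.univ, W (v i) ⁻¹' Set.Ici (x i) := by
    ext ω
    simp
  rw [h1, measureReal_def, (hi.precomp v.injective).measure_inter_preimage_eq_mul Finset.univ
    (sets := fun i => Set.Ici (x i)) fun i _ => measurableSet_Ici, ENNReal.toReal_prod]
  refine Finset.prod_congr rfl fun i _ => ?_
  rw [← hl (v i), measureReal_def, Measure.map_apply (hm _) measurableSet_Ici]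

variable [Fintype ι]

/-- The probability that distinct indices exceed prescribed levels. -/
theorem measureReal_exists_embedding_le {κ : Type*} [Fintype κ] (hm : ∀ i, Measurable (W i))
    (hl : ∀ i, P.map (W i) = ν) (hi : iIndepFun W P) (x : κ → ℝ) :
    P.real {ω | ∃ v : κ ↪ ι, ∀ i, x i ≤ W (v i) ω} ≤
      ∏ i, (Fintype.card ι * ν.real (Set.Ici (x i))) := by
  classical
  have h1 : {ω | ∃ v : κ ↪ ι, ∀ i, x i ≤ W (v i) ω} = ⋃ v : κ ↪ ι, {ω | ∀ i, x i ≤ W (v i) ω} := by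
    ext ω
    simp
  rw [h1]
  refine (measureReal_iUnion_fintype_le _).trans ?_
  simp only [measureReal_forall_le hm hl hi, Finset.sum_const, Finset.card_univ, nsmul_eq_mul,
    Finset.prod_mul_distrib, Finset.prod_const]
  gcongr
  rw [Fintype.card_embedding_eq]
  exact_mod_cast Nat.descFactorial_le_pow _ _

variable [IsProbabilityMeasure P]

/-- A factorial moment bound for the number of exceedances. -/
theorem measureReal_le_exceedances_mul_le (hm : ∀ i, Measurable (W i))
    (hl : ∀ i, P.map (W i) = ν) (hi : iIndepFun W P) (x : ℝ) (r m : ℕ) :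
    ((m + 1 - r : ℕ) : ℝ) ^ r * P.real {ω | m ≤ exceedances x fun i => W i ω} ≤
      (Fintype.card ι * ν.real (Set.Ici x)) ^ r := by
  classical
  -- With `N` exceedances, `F` is the falling factorial `N (N - 1) ⋯ (N - r + 1)`; Markov's
  -- inequality is applied to it.
  set F : Ω → ℝ := fun ω => ∑ v : Fin r ↪ ι,
    Set.indicator {ω | ∀ i, x ≤ W (v i) ω} (fun _ => (1 : ℝ)) ω with hF
  have hset : ∀ v : Fin r ↪ ι, MeasurableSet {ω | ∀ i, x ≤ W (v i) ω} := fun v => by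
    have : {ω | ∀ i, x ≤ W (v i) ω} = ⋂ i, W (v i) ⁻¹' Set.Ici x := by ext; simp
    rw [this]
    exact MeasurableSet.iInter fun i => hm _ measurableSet_Ici
  have hint : ∀ v : Fin r ↪ ι, Integrable
      (Set.indicator {ω | ∀ i, x ≤ W (v i) ω} (fun _ => (1 : ℝ))) P := fun v =>
    (integrable_const _).indicator (hset v)
  have hF0 : ∀ ω, 0 ≤ F ω := fun ω => Finset.sum_nonneg fun v _ =>
    Set.indicator_nonneg (fun _ _ => zero_le_one) _
  -- Each of the `r` factors is at least `m + 1 - r`. The subtraction is truncated, so the bound is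
  -- trivial for `r > m`.
  have hsub : {ω | m ≤ exceedances x fun i => W i ω} ⊆
      {ω | ((m + 1 - r : ℕ) : ℝ) ^ r ≤ F ω} := by
    intro ω hω
    have hcard : F ω = Nat.card {v : Fin r ↪ ι // ∀ i, x ≤ W (v i) ω} := by
      simp [hF, Fintype.card_subtype, Set.indicator_apply]
    change _ ≤ F ω
    rw [hcard]
    have h1 : Nat.card (Fin r ↪ {u // x ≤ W u ω}) ≤
        Nat.card {v : Fin r ↪ ι // ∀ i, x ≤ W (v i) ω} := by
      refine Nat.card_le_card_of_injective
        (fun v => ⟨v.trans (Function.Embedding.subtype _), fun i => (v i).2⟩) fun v v' h => ?_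
      ext i
      exact congrArg (fun f : {v : Fin r ↪ ι // ∀ i, x ≤ W (v i) ω} => f.1 i) h
    rw [Nat.card_eq_fintype_card, Fintype.card_embedding_eq, Fintype.card_fin,
      ← Nat.card_eq_fintype_card] at h1
    have h2 : m ≤ Nat.card {u // x ≤ W u ω} := hω
    have h3 := Nat.pow_sub_le_descFactorial (Nat.card {u // x ≤ W u ω}) r
    have h4 : (m + 1 - r) ^ r ≤ (Nat.card {u // x ≤ W u ω} + 1 - r) ^ r :=
      Nat.pow_le_pow_left (by omega) r
    exact_mod_cast h4.trans (h3.trans h1)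
  calc ((m + 1 - r : ℕ) : ℝ) ^ r * P.real {ω | m ≤ exceedances x fun i => W i ω}
      ≤ ((m + 1 - r : ℕ) : ℝ) ^ r * P.real {ω | ((m + 1 - r : ℕ) : ℝ) ^ r ≤ F ω} := by
        exact mul_le_mul_of_nonneg_left (measureReal_mono hsub) (by positivity)
    _ ≤ ∫ ω, F ω ∂P := mul_meas_ge_le_integral_of_nonneg (Eventually.of_forall hF0)
        (integrable_finsetSum _ fun v _ => hint v) _
    _ = ∑ v : Fin r ↪ ι, P.real {ω | ∀ i, x ≤ W (v i) ω} := by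
        rw [hF, integral_finsetSum _ fun v _ => hint v]
        refine Finset.sum_congr rfl fun v _ => ?_
        rw [integral_indicator_const _ (hset v), smul_eq_mul, mul_one]
    _ = Fintype.card (Fin r ↪ ι) * ν.real (Set.Ici x) ^ r := by
        simp [measureReal_forall_le hm hl hi]
    _ ≤ (Fintype.card ι * ν.real (Set.Ici x)) ^ r := by
        rw [mul_pow]
        gcongr
        rw [Fintype.card_embedding_eq, Fintype.card_fin]
        exact_mod_cast Nat.descFactorial_le_pow _ _

theorem integral_exceedances (hm : ∀ i, Measurable (W i)) (hl : ∀ i, P.map (W i) = ν) (x : ℝ) :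
    ∫ ω, (exceedances x fun i => W i ω : ℝ) ∂P = Fintype.card ι * ν.real (Set.Ici x) := by
  have hA : ∀ i, MeasurableSet (W i ⁻¹' Set.Ici x) := fun i => hm i measurableSet_Ici
  have h1 : ∀ i, (fun ω => Set.indicator (Set.Ici x) (fun _ => (1 : ℝ)) (W i ω)) =
    Set.indicator (W i ⁻¹' Set.Ici x) (fun _ => (1 : ℝ)) := fun i => rfl
  simp only [exceedances_eq_sum]
  rw [integral_finsetSum _ fun i _ => by
    rw [h1]; exact (integrable_const _).indicator (hA i)]
  simp only [h1, integral_indicator_const _ (hA _), smul_eq_mul, mul_one]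
  have h2 : ∀ i, P.real (W i ⁻¹' Set.Ici x) = ν.real (Set.Ici x) := fun i => by
    rw [← hl i, measureReal_def, measureReal_def, Measure.map_apply (hm _) measurableSet_Ici]
  simp [h2]

/-- Off-diagonal pairs are independent and contribute at most the squared mean; the diagonal
contributes the mean. -/
theorem integral_exceedances_sq_le (hm : ∀ i, Measurable (W i)) (hl : ∀ i, P.map (W i) = ν)
    (hi : iIndepFun W P) (x : ℝ) :
    ∫ ω, (exceedances x fun i => W i ω : ℝ) ^ 2 ∂P ≤
      (Fintype.card ι * ν.real (Set.Ici x)) ^ 2 + Fintype.card ι * ν.real (Set.Ici x) := by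
  classical
  set q := ν.real (Set.Ici x) with hq
  have hA : ∀ i, MeasurableSet (W i ⁻¹' Set.Ici x) := fun i => hm i measurableSet_Ici
  have h2 : ∀ i, P.real (W i ⁻¹' Set.Ici x) = q := fun i => by
    rw [hq, ← hl i, measureReal_def, measureReal_def, Measure.map_apply (hm _) measurableSet_Ici]
  have hq0 : 0 ≤ q := measureReal_nonneg
  have h3 : ∀ i j, P.real (W i ⁻¹' Set.Ici x ∩ W j ⁻¹' Set.Ici x) ≤
      q ^ 2 + if i = j then q else 0 := by
    intro i j
    by_cases hij : i = j
    · subst hij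
      rw [Set.inter_self, h2, if_pos rfl]
      nlinarith
    · rw [if_neg hij, measureReal_def,
        (hi.indepFun hij).measure_inter_preimage_eq_mul _ _ measurableSet_Ici measurableSet_Ici,
        ENNReal.toReal_mul, ← measureReal_def, ← measureReal_def, h2, h2]
      exact le_of_eq (by ring)
  have h4 : (fun ω => (exceedances x fun i => W i ω : ℝ) ^ 2) = fun ω => ∑ i, ∑ j,
      Set.indicator (W i ⁻¹' Set.Ici x ∩ W j ⁻¹' Set.Ici x) (fun _ => (1 : ℝ)) ω := by
    ext ω
    rw [exceedances_eq_sum, sq, Finset.sum_mul_sum]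
    refine Finset.sum_congr rfl fun i _ => Finset.sum_congr rfl fun j _ => ?_
    simp only [Set.indicator_apply, Set.mem_inter_iff, Set.mem_preimage]
    by_cases h : W i ω ∈ Set.Ici x <;> by_cases h' : W j ω ∈ Set.Ici x <;> simp [h, h']
  have hint : ∀ i j, Integrable
      (Set.indicator (W i ⁻¹' Set.Ici x ∩ W j ⁻¹' Set.Ici x) (fun _ => (1 : ℝ))) P := fun i j =>
    (integrable_const _).indicator ((hA i).inter (hA j))
  rw [h4, integral_finsetSum _ fun i _ => integrable_finsetSum _ fun j _ => hint i j]
  calc _ = ∑ i, ∑ j, P.real (W i ⁻¹' Set.Ici x ∩ W j ⁻¹' Set.Ici x) := by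
        refine Finset.sum_congr rfl fun i _ => ?_
        rw [integral_finsetSum _ fun j _ => hint i j]
        refine Finset.sum_congr rfl fun j _ => ?_
        rw [integral_indicator_const _ ((hA i).inter (hA j)), smul_eq_mul, mul_one]
    _ ≤ ∑ i : ι, ∑ j : ι, (q ^ 2 + if i = j then q else 0) :=
        Finset.sum_le_sum fun i _ => Finset.sum_le_sum fun j _ => h3 i j
    _ = _ := by
        simp [Finset.sum_add_distrib]
        ring

/-- A second moment bound: the number of exceedances is more than half of its mean with probability
at least of the order of the mean, capped at one. -/
theorem le_measureReal_lt_exceedances (hm : ∀ i, Measurable (W i)) (hl : ∀ i, P.map (W i) = ν)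
    (hi : iIndepFun W P) (x : ℝ) {m : ℝ} (hmean : m = Fintype.card ι * ν.real (Set.Ici x)) :
    m / (4 * (m + 1)) ≤ P.real {ω | m / 2 < exceedances x fun i => W i ω} := by
  set N : Ω → ℝ := fun ω => exceedances x fun i => W i ω with hN
  set A : Set Ω := {ω | m / 2 < N ω} with hA
  have hm0 : 0 ≤ m := hmean ▸ mul_nonneg (Nat.cast_nonneg _) measureReal_nonneg
  have hNm : Measurable N := (measurable_exceedances x).comp (measurable_pi_lambda _ hm)
  have hAm : MeasurableSet A := measurableSet_lt measurable_const hNm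
  have hN0 : ∀ ω, 0 ≤ N ω := fun ω => Nat.cast_nonneg _
  have hNb : ∀ ω, N ω ≤ Nat.card ι := fun ω => Nat.cast_le.2 (Finite.card_subtype_le _)
  have hNi : Integrable N P := Integrable.of_bound hNm.aestronglyMeasurable (Nat.card ι)
    (Eventually.of_forall fun ω => by rw [Real.norm_of_nonneg (hN0 ω)]; exact hNb ω)
  have hN2i : Integrable (fun ω => N ω ^ 2) P :=
    Integrable.of_bound (hNm.pow_const 2).aestronglyMeasurable ((Nat.card ι : ℝ) ^ 2)
      (Eventually.of_forall fun ω => by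
        rw [Real.norm_of_nonneg (sq_nonneg _)]
        exact pow_le_pow_left₀ (hN0 ω) (hNb ω) 2)
  have hAi : Integrable (A.indicator fun _ => (1 : ℝ)) P := (integrable_const _).indicator hAm
  -- Off `A` the first term suffices; on `A` the other two do, by completing the square. The weight
  -- `1 / (4 * (m + 1))` turns the second moment bound `m ^ 2 + m` into `m / 4`, which leaves `m / 4
  -- ≤ (m + 1) * P.real A`, also when `m = 0`.
  have hpt : ∀ ω, N ω ≤ m / 2 + (m + 1) * A.indicator (fun _ => (1 : ℝ)) ω
      + 1 / (4 * (m + 1)) * N ω ^ 2 := by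
    intro ω
    have hsq : 0 ≤ 1 / (4 * (m + 1)) * N ω ^ 2 := by positivity
    by_cases h : ω ∈ A
    · rw [Set.indicator_of_mem h]
      have : 0 ≤ 1 / (4 * (m + 1)) * (N ω - 2 * (m + 1)) ^ 2 := by positivity
      have h2 : 1 / (4 * (m + 1)) * (N ω - 2 * (m + 1)) ^ 2 =
          1 / (4 * (m + 1)) * N ω ^ 2 - N ω + (m + 1) := by
        field_simp
        ring
      linarith
    · rw [Set.indicator_of_notMem h]
      have : N ω ≤ m / 2 := not_lt.1 h
      linarith
  have h1 : m ≤ m / 2 + (m + 1) * P.real A + 1 / (4 * (m + 1)) * (m ^ 2 + m) := by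
    calc m = ∫ ω, N ω ∂P := by rw [hN, integral_exceedances hm hl, hmean]
      _ ≤ ∫ ω, (m / 2 + (m + 1) * A.indicator (fun _ => (1 : ℝ)) ω
            + 1 / (4 * (m + 1)) * N ω ^ 2) ∂P :=
          integral_mono hNi (((integrable_const _).add (hAi.const_mul _)).add (hN2i.const_mul _)) hpt
      _ = m / 2 + (m + 1) * P.real A + 1 / (4 * (m + 1)) * ∫ ω, N ω ^ 2 ∂P := by
          have hAc : Integrable (fun ω => (m + 1) * A.indicator (fun _ => (1 : ℝ)) ω) P :=
            hAi.const_mul _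
          rw [integral_add (f := fun ω => m / 2 + (m + 1) * A.indicator (fun _ => (1 : ℝ)) ω)
              ((integrable_const _).add hAc) (hN2i.const_mul _),
            integral_add (integrable_const _) hAc, integral_const_mul,
            integral_const_mul, integral_indicator_const _ hAm]
          simp
      _ ≤ _ := by
          gcongr
          rw [hmean]
          exact integral_exceedances_sq_le hm hl hi x
  have h2 : 1 / (4 * (m + 1)) * (m ^ 2 + m) = m / 4 := by field_simp
  rw [h2] at h1
  rw [div_le_iff₀ (by positivity)]
  linarith

end Independent

/-! ### Independence of blocks -/

/-- Independence says that the joint law is a product measure, and currying a product over `ι × κ`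
gives a product over `ι` of products over `κ`. -/
theorem iIndepFun_blocks {ι κ Ω : Type*} [Fintype ι] [Fintype κ] [MeasurableSpace Ω]
    {P : Measure Ω} [IsProbabilityMeasure P] {X : ι × κ → Ω → ℝ} (hm : ∀ i, Measurable (X i))
    (hi : iIndepFun X P) : iIndepFun (fun (i : ι) ω (j : κ) => X (i, j) ω) P := by
  have hpm : ∀ i j, IsProbabilityMeasure (P.map (X (i, j))) := fun i j =>
    Measure.isProbabilityMeasure_map (hm (i, j)).aemeasurable
  rw [iIndepFun_iff_map_fun_eq_infinitePi_map
    fun i => measurable_pi_lambda _ fun j => hm (i, j)]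
  have h1 : (fun ω (i : ι) (j : κ) => X (i, j) ω) =
      MeasurableEquiv.curry ι κ ℝ ∘ fun ω a => X a ω := rfl
  have h2 := hi.map_fun_eq_infinitePi_map hm
  have h3 : P.map (fun ω (i : ι) (j : κ) => X (i, j) ω) =
      Measure.infinitePi fun i => Measure.infinitePi fun j => P.map (X (i, j)) := by
    rw [h1, ← Measure.map_map (MeasurableEquiv.measurable _) (measurable_pi_lambda _ hm), h2]
    exact Measure.infinitePi_map_curry fun i j => P.map (X (i, j))
  rw [h3]
  congr 1
  ext1 i
  exact ((hi.precomp (g := fun j => (i, j)) fun a b h => (Prod.ext_iff.1 h).2)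
    |>.map_fun_eq_infinitePi_map fun j => hm (i, j)).symm

/-- With the indices split into blocks, the probability that the exceedances in every block are more
than half of their mean. -/
theorem prod_le_measureReal_lt_exceedances {ι κ Ω : Type*} [Fintype ι] [Fintype κ]
    [MeasurableSpace Ω] {P : Measure Ω} [IsProbabilityMeasure P] {ν : Measure ℝ}
    {X : ι × κ → Ω → ℝ} (hm : ∀ i, Measurable (X i)) (hl : ∀ i, P.map (X i) = ν)
    (hi : iIndepFun X P) (x m : ι → ℝ)
    (hmean : ∀ i, m i = Fintype.card κ * ν.real (Set.Ici (x i))) :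
    ∏ i, m i / (4 * (m i + 1)) ≤
      P.real {ω | ∀ i, m i / 2 < exceedances (x i) fun j => X (i, j) ω} := by
  have h1 : {ω | ∀ i, m i / 2 < exceedances (x i) fun j => X (i, j) ω} =
      ⋂ i ∈ Finset.univ, (fun ω j => X (i, j) ω) ⁻¹' {w | m i / 2 < exceedances (x i) w} := by
    ext ω
    simp
  rw [h1, measureReal_def, (iIndepFun_blocks hm hi).measure_inter_preimage_eq_mul Finset.univ
    (sets := fun i => {w | m i / 2 < exceedances (x i) w})
    fun i _ => measurableSet_lt measurable_const (measurable_exceedances _), ENNReal.toReal_prod]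
  refine Finset.prod_le_prod (fun i _ => ?_) fun i _ => ?_
  · have : 0 ≤ m i := hmean i ▸ mul_nonneg (Nat.cast_nonneg _) measureReal_nonneg
    positivity
  · exact le_measureReal_lt_exceedances (fun j => hm (i, j)) (fun j => hl (i, j))
      (hi.precomp (g := fun j => (i, j)) fun a b h => (Prod.ext_iff.1 h).2) (x i) (hmean i)

/-! ### Counting labelled copies for given weights -/

theorem edgeExponent_eq_sum {k : ℕ} (H : SimpleGraph (Fin k)) (β : Fin k → ℝ) :
    edgeExponent H β = ∑ e ∈ orderedEdges H, min (β e.1 + β e.2 - 1) 0 := rfl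

theorem le_min_div_one {N μ x y a b : ℝ} (hN : 1 ≤ N) (hμ : 1 ≤ μ) (hx : N ^ a ≤ x)
    (hy : N ^ b ≤ y) : μ⁻¹ * N ^ min (a + b - 1) 0 ≤ min (x * y / (μ * N)) 1 := by
  have hN0 : 0 < N := by linarith
  refine le_min ?_ ?_
  · calc μ⁻¹ * N ^ min (a + b - 1) 0 ≤ μ⁻¹ * N ^ (a + b - 1) := by
          gcongr
          exact min_le_left _ _
      _ = N ^ a * N ^ b / (μ * N) := by
          rw [Real.rpow_sub_one hN0.ne', Real.rpow_add hN0]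
          field_simp
      _ ≤ x * y / (μ * N) := by
          have : 0 ≤ x := (Real.rpow_nonneg hN0.le a).trans hx
          gcongr
  · exact mul_le_one₀ (inv_le_one_of_one_le₀ hμ) (by positivity)
      (Real.rpow_le_one_of_one_le_of_nonpos hN (min_le_right _ _))

/-- The alternatives `1 ≤ a` and `1 ≤ b` stand for the unbounded top cell of the grid. There `a + b
- 1 ≥ 0`, and the cap of the kernel at 1 is enough; hence exponents above 1 are never needed. -/
theorem min_div_one_le {N μ x y a b δ : ℝ} (hN : 1 ≤ N) (hμ : 1 ≤ μ) (hδ : 0 ≤ δ)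
    (hy0 : 0 ≤ y) (ha : 0 ≤ a) (hb : 0 ≤ b)
    (hx : 1 ≤ a ∨ x ≤ N ^ (a + δ)) (hy : 1 ≤ b ∨ y ≤ N ^ (b + δ)) :
    min (x * y / (μ * N)) 1 ≤ N ^ (min (a + b - 1) 0 + 2 * δ) := by
  have hN0 : 0 < N := by linarith
  have htriv : 0 ≤ a + b - 1 → min (x * y / (μ * N)) 1 ≤ N ^ (min (a + b - 1) 0 + 2 * δ) := by
    intro h
    refine (min_le_right _ _).trans (Real.one_le_rpow hN ?_)
    rw [min_eq_right h]
    linarith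
  rcases hx with hx | hx
  · exact htriv (by linarith)
  rcases hy with hy | hy
  · exact htriv (by linarith)
  rcases le_total 0 (a + b - 1) with h | h
  · exact htriv h
  · refine (min_le_left _ _).trans ?_
    rw [min_eq_left h]
    calc x * y / (μ * N) ≤ N ^ (a + δ) * N ^ (b + δ) / (1 * N) := by gcongr
      _ = N ^ (a + b - 1 + 2 * δ) := by
          rw [← Real.rpow_add hN0, one_mul, ← Real.rpow_sub_one hN0.ne']
          congr 1
          ring

/-- Weights of size at least `n ^ β` give a lower bound for the number of copies. -/
theorem le_expectedLabelledCount {k n m : ℕ} (hn : 1 ≤ n) (H : SimpleGraph (Fin k)) {μ c : ℝ}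
    (hμ : 1 ≤ μ) (hc : 0 < c) {w : Fin n → ℝ} {q : Sym2 (Fin n) → ℝ}
    (hq0 : ∀ e, 0 ≤ q e)
    (hq : ∀ i j, i ≠ j → c * min (w i * w j / (μ * n)) 1 ≤ q s(i, j))
    (b : Fin k × Fin m ↪ Fin n) (β : Fin k → ℝ) :
    (∏ i, (exceedances ((n : ℝ) ^ β i) fun j => w (b (i, j)) : ℝ)) *
      ((c * μ⁻¹) ^ (orderedEdges H).card * (n : ℝ) ^ edgeExponent H β) ≤
      expectedLabelledCount H q := by
  classical
  have hn1 : (1 : ℝ) ≤ n := by exact_mod_cast hn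
  have hn0 : (0 : ℝ) < n := by linarith
  set L : ℝ := (c * μ⁻¹) ^ (orderedEdges H).card * (n : ℝ) ^ edgeExponent H β with hL
  have hL0 : 0 ≤ L := by positivity
  set S : Finset (Fin k ↪ Fin n) := {v | ∀ i, (n : ℝ) ^ β i ≤ w (v i)} with hS
  have hterm : ∀ v ∈ S, L ≤ ∏ e ∈ orderedEdges H, q s(v e.1, v e.2) := by
    intro v hv
    have hv' := (Finset.mem_filter.1 hv).2
    rw [hL, edgeExponent_eq_sum, Real.rpow_sum_of_pos hn0, ← Finset.prod_const,
      ← Finset.prod_mul_distrib]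
    refine Finset.prod_le_prod (fun e _ => by positivity) fun e he => ?_
    refine le_trans ?_ (hq _ _ (v.injective.ne (mem_orderedEdges.1 he).1.ne))
    rw [mul_assoc]
    gcongr
    exact le_min_div_one hn1 hμ (hv' _) (hv' _)
  -- Picking one exceeding vertex in each block gives an embedding, since the blocks are disjoint.
  have hcard : (∏ i, exceedances ((n : ℝ) ^ β i) fun j => w (b (i, j))) ≤ S.card := by
    rw [hS, ← Fintype.card_subtype, ← Nat.card_eq_fintype_card]
    simp only [exceedances]
    rw [← Nat.card_pi]
    refine Nat.card_le_card_of_injective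
      (fun u => ⟨⟨fun i => b (i, (u i).1), fun i j hij => ?_⟩, fun i => (u i).2⟩) fun u u' h => ?_
    · exact (Prod.ext_iff.1 (b.injective hij)).1
    · ext i
      have := congrArg (fun v : {v : Fin k ↪ Fin n // ∀ i, (n : ℝ) ^ β i ≤ w (v i)} => v.1 i) h
      exact congrArg Fin.val (Prod.ext_iff.1 (b.injective this)).2
  calc _ ≤ (S.card : ℝ) * L := by
        gcongr
        exact_mod_cast hcard
    _ = ∑ v ∈ S, L := by rw [Finset.sum_const, nsmul_eq_mul]
    _ ≤ ∑ v ∈ S, ∏ e ∈ orderedEdges H, q s(v e.1, v e.2) := Finset.sum_le_sum hterm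
    _ ≤ expectedLabelledCount H q := Finset.sum_le_sum_of_subset_of_nonneg (Finset.subset_univ _)
        fun v _ _ => Finset.prod_nonneg fun e _ => hq0 _

/-- Every weight lies in a cell of the grid `n ^ (j / J)`, where the last cell is unbounded. -/
theorem exists_gridCell {J : ℕ} (hJ : 0 < J) {N x : ℝ} (hx : 1 ≤ x) :
    ∃ j : Fin (J + 1), N ^ ((j : ℝ) / J) ≤ x ∧
      (1 ≤ (j : ℝ) / J ∨ x ≤ N ^ ((j : ℝ) / J + 1 / J)) := by
  classical
  have hJ' : (0 : ℝ) < J := by exact_mod_cast hJ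
  have h0 : N ^ (((0 : ℕ) : ℝ) / J) ≤ x := by simpa using hx
  -- The largest grid point below `x`; the index 0 always qualifies because `1 ≤ x`.
  set m := Nat.findGreatest (fun j : ℕ => N ^ ((j : ℝ) / J) ≤ x) J with hm
  have hmJ : m ≤ J := Nat.findGreatest_le J
  refine ⟨⟨m, by omega⟩, Nat.findGreatest_spec (P := fun j : ℕ => N ^ ((j : ℝ) / J) ≤ x)
    (Nat.zero_le J) h0, ?_⟩
  rcases hmJ.eq_or_lt with h | h
  · left
    simp only [h]
    rw [div_self hJ'.ne']
  · right
    have := Nat.findGreatest_is_greatest (P := fun j : ℕ => N ^ ((j : ℝ) / J) ≤ x)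
      (Nat.lt_succ_self m) h
    have h2 : ((m : ℝ) / J + 1 / J) = ((m + 1 : ℕ) : ℝ) / J := by push_cast; ring
    simp only [h2]
    exact (not_le.1 this).le

/-- If there are many copies, then many of them, up to a constant factor, have vertices whose
weights lie in prescribed cells of the grid. -/
theorem exists_grid_of_lt_expectedLabelledCount {k n J : ℕ} (hn : 1 ≤ n) (hJ : 0 < J)
    (H : SimpleGraph (Fin k)) {μ C t : ℝ} (hμ : 1 ≤ μ) (hC : 0 < C) (ht : 0 ≤ t)
    {w : Fin n → ℝ} (hw : ∀ i, 1 ≤ w i) {q : Sym2 (Fin n) → ℝ} (hq0 : ∀ e, 0 ≤ q e)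
    (hq : ∀ i j, i ≠ j → q s(i, j) ≤ C * min (w i * w j / (μ * n)) 1)
    (h : t < expectedLabelledCount H q) :
    ∃ j : Fin k → Fin (J + 1), (∃ v : Fin k ↪ Fin n, ∀ i, (n : ℝ) ^ ((j i : ℝ) / J) ≤ w (v i)) ∧
      t < ((J : ℝ) + 1) ^ k * ((∏ i, (exceedances ((n : ℝ) ^ ((j i : ℝ) / J)) w : ℝ)) *
        (C ^ (orderedEdges H).card * (n : ℝ) ^ (edgeExponent H (fun i => (j i : ℝ) / J) +
          (orderedEdges H).card * (2 * (1 / (J : ℝ)))))) := by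
  classical
  have hn1 : (1 : ℝ) ≤ n := by exact_mod_cast hn
  have hn0 : (0 : ℝ) < n := by linarith
  choose cls hcls1 hcls2 using fun i => exists_gridCell hJ (N := n) (hw i)
  set F : (Fin k ↪ Fin n) → ℝ := fun v => ∏ e ∈ orderedEdges H, q s(v e.1, v e.2) with hF
  have hfib : expectedLabelledCount H q = ∑ j : Fin k → Fin (J + 1),
      ∑ v : Fin k ↪ Fin n with (fun i => cls (v i)) = j, F v :=
    (Finset.sum_fiberwise _ _ _).symm
  -- Pigeonhole over the `(J + 1) ^ k` assignments of cells to the vertices of `H`.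
  obtain ⟨j, hj⟩ : ∃ j : Fin k → Fin (J + 1), t < ((J : ℝ) + 1) ^ k *
      ∑ v : Fin k ↪ Fin n with (fun i => cls (v i)) = j, F v := by
    by_contra! hcon
    have h1 := Finset.sum_le_sum fun j (_ : j ∈ Finset.univ) => hcon j
    rw [← Finset.mul_sum, ← hfib, Finset.sum_const, Finset.card_univ, nsmul_eq_mul] at h1
    simp only [Fintype.card_pi, Fintype.card_fin, Finset.prod_const, Finset.card_univ] at h1
    push_cast at h1
    exact absurd (le_of_mul_le_mul_left h1 (by positivity)) (not_le.2 h)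
  set S : Finset (Fin k ↪ Fin n) := {v | (fun i => cls (v i)) = j} with hS
  have hmem : ∀ v ∈ S, ∀ i, cls (v i) = j i := fun v hv i =>
    congrFun (Finset.mem_filter.1 hv).2 i
  refine ⟨j, ?_, hj.trans_le ?_⟩
  · have hne : S.Nonempty := by
      by_contra hemp
      rw [Finset.not_nonempty_iff_eq_empty.1 hemp, Finset.sum_empty, mul_zero] at hj
      linarith
    obtain ⟨v, hv⟩ := hne
    exact ⟨v, fun i => hmem v hv i ▸ hcls1 (v i)⟩
  · gcongr ?_ * ?_
    set U : ℝ := C ^ (orderedEdges H).card * (n : ℝ) ^ (edgeExponent H (fun i => (j i : ℝ) / J) +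
          (orderedEdges H).card * (2 * (1 / (J : ℝ)))) with hU
    have hU0 : 0 ≤ U := by positivity
    have hterm : ∀ v ∈ S, F v ≤ U := by
      intro v hv
      have hexp : edgeExponent H (fun i => (j i : ℝ) / J) +
          (orderedEdges H).card * (2 * (1 / (J : ℝ))) = ∑ e ∈ orderedEdges H,
            (min ((j e.1 : ℝ) / J + (j e.2 : ℝ) / J - 1) 0 + 2 * (1 / (J : ℝ))) := by
        rw [Finset.sum_add_distrib, Finset.sum_const, nsmul_eq_mul, edgeExponent_eq_sum]
      rw [hU, hexp, Real.rpow_sum_of_pos hn0, ← Finset.prod_const, ← Finset.prod_mul_distrib]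
      refine Finset.prod_le_prod (fun e _ => hq0 _) fun e he => ?_
      refine (hq _ _ (v.injective.ne (mem_orderedEdges.1 he).1.ne)).trans ?_
      gcongr
      have h1 := hcls2 (v e.1)
      have h2 := hcls2 (v e.2)
      rw [hmem v hv] at h1 h2
      exact min_div_one_le hn1 hμ (by positivity)
        (zero_le_one.trans (hw _)) (by positivity) (by positivity) h1 h2
    have hcard : S.card ≤ ∏ i, exceedances ((n : ℝ) ^ ((j i : ℝ) / J)) w := by
      simp only [exceedances]
      rw [← Nat.card_pi, ← Fintype.card_coe, ← Nat.card_eq_fintype_card]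
      refine Nat.card_le_card_of_injective
        (fun v : S => fun i => ⟨v.1 i, hmem v.1 v.2 i ▸ hcls1 (v.1 i)⟩) fun v v' hvv => ?_
      refine Subtype.ext (DFunLike.ext _ _ fun i => ?_)
      exact congrArg Subtype.val (congrFun hvv i)
    calc ∑ v ∈ S, F v ≤ ∑ v ∈ S, U := Finset.sum_le_sum hterm
      _ = S.card * U := by rw [Finset.sum_const, nsmul_eq_mul]
      _ ≤ _ := by
        gcongr
        exact_mod_cast hcard

/-! ### The rate -/

theorem continuous_copyExponent {k : ℕ} (H : SimpleGraph (Fin k)) (α : ℝ) :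
    Continuous (copyExponent H α) := by
  unfold copyExponent edgeExponent; fun_prop

theorem continuous_hubExponent {k : ℕ} (α : ℝ) : Continuous (hubExponent (k := k) α) := by
  unfold hubExponent; fun_prop

/-- Relaxing the constraint slightly changes the rate only slightly. -/
theorem exists_hubExponent_lt_of_relaxed {k : ℕ} (H : SimpleGraph (Fin k)) (α γ : ℝ)
    (h : (feasibleSet H α γ).Nonempty) {ε : ℝ} (hε : 0 < ε) :
    ∃ η > 0, ∀ β ∈ Set.Icc (0 : Fin k → ℝ) 1, γ - η ≤ copyExponent H α β →
      hubExponent α β < rate H α γ + ε := by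
  -- On the compact set `K` of vectors that beat the rate by `ε`, `copyExponent` attains a maximum,
  -- necessarily below `γ`; half of this gap serves as `η`.
  set K : Set (Fin k → ℝ) := Set.Icc 0 1 ∩ {β | rate H α γ + ε ≤ hubExponent α β} with hK
  have hKc : IsCompact K :=
    isCompact_Icc.inter_right (isClosed_le continuous_const (continuous_hubExponent α))
  rcases K.eq_empty_or_nonempty with hemp | hne
  · refine ⟨1, one_pos, fun β hβ _ => ?_⟩
    by_contra hcon
    have : β ∈ K := ⟨hβ, not_lt.1 hcon⟩
    simp [hemp] at this
  · obtain ⟨β₀, hβ₀, hmax⟩ := hKc.exists_isMaxOn hne (continuous_copyExponent H α).continuousOn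
    have hlt : copyExponent H α β₀ < γ := by
      by_contra hcon
      have h1 := (isGreatest_rate H α γ h).2 ⟨β₀, ⟨hβ₀.1, not_lt.1 hcon⟩, rfl⟩
      have h2 : rate H α γ + ε ≤ hubExponent α β₀ := hβ₀.2
      linarith
    refine ⟨(γ - copyExponent H α β₀) / 2, by linarith, fun β hβ hcopy => ?_⟩
    by_contra hcon
    have : copyExponent H α β ≤ copyExponent H α β₀ := hmax (⟨hβ, not_lt.1 hcon⟩ : β ∈ K)
    linarith

/-! ### The upper bound -/

theorem eventually_le_natCast_rpow (A : ℝ) {s : ℝ} (hs : 0 < s) :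
    ∀ᶠ n : ℕ in atTop, A ≤ (n : ℝ) ^ s :=
  ((tendsto_rpow_atTop hs).comp tendsto_natCast_atTop_atTop).eventually_ge_atTop A

theorem card_mul_tail_le {ν : Measure ℝ} {α C : ℝ}
    (htail : ∀ x : ℝ, 1 ≤ x → ν.real (Set.Ici x) ≤ C * x ^ (-α)) {n : ℕ} (hn : 1 ≤ n) {b : ℝ}
    (hb : 0 ≤ b) : n * ν.real (Set.Ici ((n : ℝ) ^ b)) ≤ C * (n : ℝ) ^ (1 - α * b) := by
  have hn1 : (1 : ℝ) ≤ n := by exact_mod_cast hn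
  have hn0 : (0 : ℝ) < n := by linarith
  calc n * ν.real (Set.Ici ((n : ℝ) ^ b)) ≤ n * (C * ((n : ℝ) ^ b) ^ (-α)) := by
        gcongr
        exact htail _ (Real.one_le_rpow hn1 hb)
    _ = C * (n : ℝ) ^ (1 - α * b) := by
        rw [← Real.rpow_mul hn0.le, sub_eq_add_neg, Real.rpow_add hn0, Real.rpow_one,
          show b * -α = -(α * b) by ring]
        ring

/-- The probability that distinct vertices have weights at least `n ^ β i`. -/
theorem measureReal_exists_hubs_le {k n : ℕ} {Ω : Type*} [MeasurableSpace Ω] {P : Measure Ω}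
    [IsProbabilityMeasure P] {ν : Measure ℝ} {W : Fin n → Ω → ℝ} (hm : ∀ i, Measurable (W i))
    (hl : ∀ i, P.map (W i) = ν) (hi : iIndepFun W P) {α C : ℝ} (hC : 1 ≤ C)
    (htail : ∀ x : ℝ, 1 ≤ x → ν.real (Set.Ici x) ≤ C * x ^ (-α)) (hn : 1 ≤ n)
    {β : Fin k → ℝ} (hβ : ∀ i, 0 ≤ β i) :
    P.real {ω | ∃ v : Fin k ↪ Fin n, ∀ i, (n : ℝ) ^ β i ≤ W (v i) ω} ≤
      C ^ k * (n : ℝ) ^ hubExponent α β := by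
  classical
  have hn1 : (1 : ℝ) ≤ n := by exact_mod_cast hn
  have hn0 : (0 : ℝ) < n := by linarith
  -- Only hub coordinates are kept: for the others the union bound would cost a positive power of
  -- `n`, although they are typically present for free.
  calc P.real {ω | ∃ v : Fin k ↪ Fin n, ∀ i, (n : ℝ) ^ β i ≤ W (v i) ω}
      ≤ P.real {ω | ∃ v : {i // 1 - α * β i < 0} ↪ Fin n,
          ∀ i, (n : ℝ) ^ β i.1 ≤ W (v i) ω} := measureReal_mono fun ω ⟨v, hv⟩ =>
        ⟨(Function.Embedding.subtype _).trans v, fun i => hv i.1⟩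
    _ ≤ ∏ i : {i // 1 - α * β i < 0}, (Fintype.card (Fin n) *
          ν.real (Set.Ici ((n : ℝ) ^ β i.1))) :=
        measureReal_exists_embedding_le hm hl hi fun i : {i // 1 - α * β i < 0} => (n : ℝ) ^ β i.1
    _ = ∏ i, if 1 - α * β i < 0 then n * ν.real (Set.Ici ((n : ℝ) ^ β i)) else 1 := by
        rw [← Finset.prod_filter, Fintype.card_fin]
        exact (Finset.prod_subtype _ (fun i => by simp)
          fun i => n * ν.real (Set.Ici ((n : ℝ) ^ β i))).symm
    _ ≤ ∏ i, C * (n : ℝ) ^ min (1 - α * β i) 0 := by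
        refine Finset.prod_le_prod (fun i _ => ?_) fun i _ => ?_
        · split_ifs
          · exact mul_nonneg hn0.le measureReal_nonneg
          · exact zero_le_one
        · split_ifs with h
          · rw [min_eq_left h.le]
            exact card_mul_tail_le htail hn (hβ i)
          · rw [min_eq_right (not_lt.1 h), Real.rpow_zero, mul_one]
            exact hC
    _ = C ^ k * (n : ℝ) ^ hubExponent α β := by
        rw [Finset.prod_mul_distrib, Finset.prod_const, Finset.card_univ, Fintype.card_fin,
          hubExponent, Real.rpow_sum_of_pos hn0]

/-- The number of vertices of weight at least `n ^ b` exceeds its typical order of magnitude by a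
power of `n` with a probability smaller than any given power of `n`. -/
theorem measureReal_le_exceedances_le {n : ℕ} {Ω : Type*} [MeasurableSpace Ω] {P : Measure Ω}
    [IsProbabilityMeasure P] {ν : Measure ℝ} {W : Fin n → Ω → ℝ} (hm : ∀ i, Measurable (W i))
    (hl : ∀ i, P.map (W i) = ν) (hi : iIndepFun W P) {α C : ℝ}
    (htail : ∀ x : ℝ, 1 ≤ x → ν.real (Set.Ici x) ≤ C * x ^ (-α)) (hn : 1 ≤ n)
    {b δ : ℝ} (hb : 0 ≤ b) (r : ℕ) (hr : 2 * (r : ℝ) ≤ (n : ℝ) ^ δ) (hC0 : 0 ≤ C)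
    (hC : 2 * C ≤ (n : ℝ) ^ (δ / 2)) :
    P.real {ω | (n : ℝ) ^ (max (1 - α * b) 0 + δ) ≤
      exceedances ((n : ℝ) ^ b) fun i => W i ω} ≤ (n : ℝ) ^ (-(δ / 2) * r) := by
  have hn1 : (1 : ℝ) ≤ n := by exact_mod_cast hn
  have hn0 : (0 : ℝ) < n := by linarith
  set a := max (1 - α * b) 0 with ha
  set y := (n : ℝ) ^ (a + δ) with hy
  have hy0 : 0 < y := by positivity
  have hyr : 2 * (r : ℝ) ≤ y := by
    rw [hy, Real.rpow_add hn0]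
    exact hr.trans (le_mul_of_one_le_left (by positivity)
      (Real.one_le_rpow hn1 (le_max_right _ _)))
  have hset : {ω | y ≤ exceedances ((n : ℝ) ^ b) fun i => W i ω} =
      {ω | ⌈y⌉₊ ≤ exceedances ((n : ℝ) ^ b) fun i => W i ω} := by
    ext ω
    exact (Nat.ceil_le (a := y)).symm
  rw [hset]
  set p := P.real {ω | ⌈y⌉₊ ≤ exceedances ((n : ℝ) ^ b) fun i => W i ω} with hp
  have hp0 : 0 ≤ p := measureReal_nonneg
  have h1 := measureReal_le_exceedances_mul_le hm hl hi ((n : ℝ) ^ b) r ⌈y⌉₊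
  rw [← hp, Fintype.card_fin] at h1
  have h2 : y / 2 ≤ ((⌈y⌉₊ + 1 - r : ℕ) : ℝ) := by
    have h3 : (⌈y⌉₊ : ℝ) + 1 ≤ ((⌈y⌉₊ + 1 - r : ℕ) : ℝ) + r := by
      exact_mod_cast (by omega : ⌈y⌉₊ + 1 ≤ (⌈y⌉₊ + 1 - r) + r)
    have := Nat.le_ceil y
    linarith
  have h4 : (y / 2) ^ r * p ≤ (C * (n : ℝ) ^ a) ^ r := by
    calc (y / 2) ^ r * p ≤ ((⌈y⌉₊ + 1 - r : ℕ) : ℝ) ^ r * p := by gcongr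
      _ ≤ (n * ν.real (Set.Ici ((n : ℝ) ^ b))) ^ r := h1
      _ ≤ (C * (n : ℝ) ^ a) ^ r := by
          refine pow_le_pow_left₀ (mul_nonneg hn0.le measureReal_nonneg) ?_ r
          refine (card_mul_tail_le htail hn hb).trans ?_
          gcongr
          exact le_max_left _ _
  -- The mean is smaller than half the threshold by the factor `n ^ (-(δ / 2))`, and the `r`-th
  -- factorial moment gains this factor `r` times.
  have h5 : C * (n : ℝ) ^ a ≤ y / 2 * (n : ℝ) ^ (-(δ / 2)) := by
    have : y * (n : ℝ) ^ (-(δ / 2)) = (n : ℝ) ^ a * (n : ℝ) ^ (δ / 2) := by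
      rw [hy, ← Real.rpow_add hn0, ← Real.rpow_add hn0]
      congr 1
      ring
    have h6 : (n : ℝ) ^ a * (2 * C) ≤ (n : ℝ) ^ a * (n : ℝ) ^ (δ / 2) := by gcongr
    linarith
  have h7 : (y / 2) ^ r * p ≤ (y / 2) ^ r * ((n : ℝ) ^ (-(δ / 2))) ^ r := by
    rw [← mul_pow]
    exact h4.trans (by gcongr)
  rw [Real.rpow_mul_natCast hn0.le]
  exact le_of_mul_le_mul_left h7 (by positivity)

section

variable {k : ℕ} (H : SimpleGraph (Fin k)) {α γ : ℝ} {ν : Measure ℝ}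
  {p : ∀ n : ℕ, Sym2 (Fin n) → (Fin n → ℝ) → ℝ} {Ω : ℕ → Type*} [∀ n, MeasurableSpace (Ω n)]
  {P : ∀ n, Measure (Ω n)} [∀ n, IsProbabilityMeasure (P n)]
  {W : ∀ n, Fin n → Ω n → ℝ} {G : ∀ n, Ω n → SimpleGraph (Fin n)}

/-- Outside the events `bad`, all grid counts are typical up to `n ^ δ`, so many copies force an
event `hit j` with `β j` feasible up to `η`. There are boundedly many such events, each of
probability at most a constant times `n ^ (rate H α γ + ε / 2)`. -/
theorem eventually_measureReal_le (hα : 1 < α) (hfeas : (feasibleSet H α γ).Nonempty)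
    (hν : IsPowerLaw α ν) (hp : IsConnectionProbability ν p)
    (hG : ∀ n, IsInhomogeneousRandomGraph (P n) ν (p n) (W n) (G n)) {ε : ℝ} (hε : 0 < ε) :
    ∀ᶠ n : ℕ in atTop,
      (P n).real {ω | (n : ℝ) ^ γ < condCopyCount H (P n) (W n) (G n) ω} ≤
        (n : ℝ) ^ (rate H α γ + ε) := by
  classical
  obtain ⟨_, D₀, -, hD₀, htail₀⟩ := hν.exists_tail_bounds (by linarith : 0 < α)
  set D : ℝ := max D₀ 1 with hD
  have hD1 : 1 ≤ D := le_max_right _ _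
  have htail : ∀ x : ℝ, 1 ≤ x → ν.real (Set.Ici x) ≤ D * x ^ (-α) := fun x hx =>
    (htail₀ x hx).2.trans (by gcongr; exact le_max_left _ _)
  obtain ⟨_, C, -, hC, hCp⟩ := hp.theta
  have hμ := hν.one_le_mean hα
  set E : ℕ := (orderedEdges H).card with hE
  obtain ⟨η, hη, hηrate⟩ := exists_hubExponent_lt_of_relaxed H α γ hfeas (half_pos hε)
  -- The slack `η` is split: one half pays for the grid error of `2 / J` per edge, the other for `k
  -- + 1` factors `n ^ δ`, namely one per vertex count and one for the constants.
  obtain ⟨J, hJ0, hJ⟩ : ∃ J : ℕ, 0 < J ∧ (E : ℝ) * (2 * (1 / (J : ℝ))) ≤ η / 2 := by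
    refine ⟨⌈4 * (E : ℝ) / η⌉₊ + 1, Nat.succ_pos _, ?_⟩
    have h1 : 4 * (E : ℝ) / η ≤ ((⌈4 * (E : ℝ) / η⌉₊ + 1 : ℕ) : ℝ) :=
      (Nat.le_ceil _).trans (by push_cast; linarith)
    have h2 : (0 : ℝ) < ((⌈4 * (E : ℝ) / η⌉₊ + 1 : ℕ) : ℝ) := by positivity
    rw [div_le_iff₀ hη] at h1
    rw [show (E : ℝ) * (2 * (1 / ((⌈4 * (E : ℝ) / η⌉₊ + 1 : ℕ) : ℝ))) =
      2 * E / ((⌈4 * (E : ℝ) / η⌉₊ + 1 : ℕ) : ℝ) by ring, div_le_iff₀ h2]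
    linarith
  set δ : ℝ := η / (2 * (k + 1)) with hδ
  have hδ0 : 0 < δ := by positivity
  have hδk : (k : ℝ) * δ + δ = η / 2 := by
    rw [hδ]
    field_simp
  obtain ⟨r, hr⟩ : ∃ r : ℕ, -(δ / 2) * r ≤ rate H α γ + ε / 2 := by
    obtain ⟨r, hr⟩ := exists_nat_ge (-(rate H α γ + ε / 2) / (δ / 2))
    rw [div_le_iff₀ (by positivity)] at hr
    exact ⟨r, by linarith⟩
  set β : (Fin k → Fin (J + 1)) → Fin k → ℝ := fun j i => (j i : ℝ) / J with hβ
  have hJ' : (0 : ℝ) < J := by exact_mod_cast hJ0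
  have hβ0 : ∀ j i, 0 ≤ β j i := fun j i => by positivity
  have hβmem : ∀ j, β j ∈ Set.Icc (0 : Fin k → ℝ) 1 := fun j => ⟨hβ0 j, fun i => by
    have : (j i : ℝ) ≤ J := by exact_mod_cast Nat.lt_succ_iff.1 (j i).2
    exact div_le_one_of_le₀ this hJ'.le⟩
  -- The number of `bad` events, plus `D ^ k` for each possible `hit` event.
  set M : ℝ := (J + 1 : ℝ) + (J + 1 : ℝ) ^ k * D ^ k with hM
  filter_upwards [hCp, eventually_ge_atTop 2, eventually_le_natCast_rpow (2 * r) hδ0,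
    eventually_le_natCast_rpow (2 * D) (half_pos hδ0),
    eventually_le_natCast_rpow ((J + 1 : ℝ) ^ k * C ^ E) hδ0,
    eventually_le_natCast_rpow M (half_pos hε)] with n hpn hn hrn hDn hcn hMn
  have hn1 : (1 : ℝ) < n := by exact_mod_cast hn
  have hn0 : (0 : ℝ) < n := by linarith
  have hn1' : 1 ≤ n := by omega
  have hm := (hG n).measurable_weight
  have hl := (hG n).law_weight
  have hi := (hG n).indep_weight
  set bad : Fin (J + 1) → Set (Ω n) := fun l =>
    {ω | (n : ℝ) ^ (max (1 - α * ((l : ℝ) / J)) 0 + δ) ≤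
      exceedances ((n : ℝ) ^ ((l : ℝ) / J)) fun i => W n i ω} with hbad
  set hit : (Fin k → Fin (J + 1)) → Set (Ω n) := fun j =>
    {ω | ∃ v : Fin k ↪ Fin n, ∀ i, (n : ℝ) ^ β j i ≤ W n (v i) ω} with hhit
  set S : Finset (Fin k → Fin (J + 1)) := {j | γ - η ≤ copyExponent H α (β j)} with hS
  have hbadP : ∀ l, (P n).real (bad l) ≤ (n : ℝ) ^ (rate H α γ + ε / 2) := fun l =>
    (measureReal_le_exceedances_le hm hl hi htail hn1' (by positivity) r hrn (by positivity)
      hDn).trans (Real.rpow_le_rpow_of_exponent_le hn1.le hr)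
  have hhitP : ∀ j ∈ S, (P n).real (hit j) ≤ D ^ k * (n : ℝ) ^ (rate H α γ + ε / 2) :=
    fun j hj => (measureReal_exists_hubs_le hm hl hi hD1 htail hn1' (hβ0 j)).trans (by
      gcongr
      · exact hn1.le
      · exact (hηrate (β j) (hβmem j) (Finset.mem_filter.1 hj).2).le)
  have hsub : ∀ᵐ ω ∂P n, (n : ℝ) ^ γ < condCopyCount H (P n) (W n) (G n) ω →
      ω ∈ (⋃ l, bad l) ∪ ⋃ j ∈ S, hit j := by
    filter_upwards [(hG n).condCopyCount_le H, (hG n).ae_one_le hν] with ω hle hW hω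
    by_contra hcon
    simp only [Set.mem_union, Set.mem_iUnion, not_or, not_exists] at hcon
    obtain ⟨hnb, hnh⟩ := hcon
    obtain ⟨j, hv, hj⟩ := exists_grid_of_lt_expectedLabelledCount hn1' hJ0 H hμ hC
      (Real.rpow_nonneg hn0.le γ) hW
      (fun e => ((hp.mem_unitInterval n e _ hW).1)) (fun i i' hii => (hpn _ hW i i' hii).2)
      (hω.trans_le hle)
    refine hnh j ?_ hv
    refine Finset.mem_filter.2 ⟨Finset.mem_univ _, ?_⟩
    have hN : ∏ i, (exceedances ((n : ℝ) ^ ((j i : ℝ) / J)) fun i => W n i ω : ℝ) ≤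
        (n : ℝ) ^ (∑ i, (max (1 - α * β j i) 0 + δ)) := by
      rw [Real.rpow_sum_of_pos hn0]
      exact Finset.prod_le_prod (fun i _ => Nat.cast_nonneg _) fun i _ => (not_le.1 (hnb (j i))).le
    have hlt : (n : ℝ) ^ γ < (n : ℝ) ^ (δ + ((∑ i, (max (1 - α * β j i) 0 + δ)) +
        (edgeExponent H (β j) + E * (2 * (1 / (J : ℝ)))))) := by
      refine hj.trans_le ?_
      rw [Real.rpow_add hn0 δ, Real.rpow_add hn0 (∑ i, (max (1 - α * β j i) 0 + δ))]
      calc _ ≤ ((J : ℝ) + 1) ^ k * ((n : ℝ) ^ (∑ i, (max (1 - α * β j i) 0 + δ)) *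
            (C ^ E * (n : ℝ) ^ (edgeExponent H (β j) + E * (2 * (1 / (J : ℝ)))))) := by gcongr
        _ = ((J : ℝ) + 1) ^ k * C ^ E * ((n : ℝ) ^ (∑ i, (max (1 - α * β j i) 0 + δ)) *
            (n : ℝ) ^ (edgeExponent H (β j) + E * (2 * (1 / (J : ℝ))))) := by ring
        _ ≤ _ := by gcongr
    rw [Real.rpow_lt_rpow_left_iff hn1, Finset.sum_add_distrib, Finset.sum_const,
      Finset.card_univ, Fintype.card_fin, nsmul_eq_mul] at hlt
    rw [copyExponent]
    linarith
  calc (P n).real {ω | (n : ℝ) ^ γ < condCopyCount H (P n) (W n) (G n) ω}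
      ≤ (P n).real ((⋃ l, bad l) ∪ ⋃ j ∈ S, hit j) :=
        ENNReal.toReal_mono (measure_ne_top _ _) (measure_mono_ae hsub)
    _ ≤ ∑ l, (P n).real (bad l) + ∑ j ∈ S, (P n).real (hit j) :=
        (measureReal_union_le _ _).trans (add_le_add (measureReal_iUnion_fintype_le _)
          (measureReal_biUnion_finset_le _ _))
    _ ≤ ∑ l : Fin (J + 1), (n : ℝ) ^ (rate H α γ + ε / 2) +
          ∑ j ∈ S, D ^ k * (n : ℝ) ^ (rate H α γ + ε / 2) :=
        add_le_add (Finset.sum_le_sum fun l _ => hbadP l) (Finset.sum_le_sum hhitP)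
    _ ≤ M * (n : ℝ) ^ (rate H α γ + ε / 2) := by
        have hcard : (S.card : ℝ) ≤ (J + 1 : ℝ) ^ k := by
          have h1 : S.card ≤ (J + 1) ^ k := by
            simpa using Finset.card_le_univ S
          exact_mod_cast h1
        rw [Finset.sum_const, Finset.sum_const, Finset.card_univ, Fintype.card_fin,
          nsmul_eq_mul, nsmul_eq_mul, hM, add_mul, ← mul_assoc]
        push_cast
        gcongr
    _ ≤ (n : ℝ) ^ (ε / 2) * (n : ℝ) ^ (rate H α γ + ε / 2) := by gcongr
    _ = (n : ℝ) ^ (rate H α γ + ε) := by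
        rw [← Real.rpow_add hn0]
        congr 1
        ring

/-! ### The lower bound -/

/-- Dividing by `k + 1` instead of `k` avoids a division by zero when `k = 0`. -/
theorem exists_blocks (k n : ℕ) : Nonempty (Fin k × Fin (n / (k + 1)) ↪ Fin n) := by
  refine ⟨finProdFinEquiv.toEmbedding.trans (Fin.castLEEmb ?_)⟩
  calc k * (n / (k + 1)) ≤ (k + 1) * (n / (k + 1)) := by gcongr; omega
    _ ≤ n := Nat.mul_div_le n (k + 1)

/-- The second moment bound `m / (4 * (m + 1))` is of order `min m 1`: a power of `N` is lost only
when the mean is small. -/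
theorem const_mul_rpow_min_le {N c m s : ℝ} (hN : 1 ≤ N) (hc0 : 0 < c) (hc1 : c ≤ 1)
    (hm : c * N ^ s ≤ m) : c / 8 * N ^ min s 0 ≤ m / (4 * (m + 1)) := by
  have hN0 : 0 < N := by linarith
  have hy0 : 0 < N ^ s := by positivity
  have hcy : 0 < c * N ^ s := by positivity
  have hm0 : 0 < m := hcy.trans_le hm
  rw [le_div_iff₀ (by positivity)]
  rcases le_total s 0 with h | h
  · rw [min_eq_left h]
    have h1 : N ^ s ≤ 1 := Real.rpow_le_one_of_one_le_of_nonpos hN h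
    nlinarith [mul_le_mul_of_nonneg_left h1 hc0.le]
  · rw [min_eq_right h, Real.rpow_zero]
    have h1 : 1 ≤ N ^ s := Real.one_le_rpow hN h
    nlinarith [mul_le_mul_of_nonneg_left h1 hc0.le]

/-- For `s ≤ 0` integrality does the work: a count above `m / 2 ≥ 0` is positive, hence at least 1.
-/
theorem const_mul_rpow_max_le {N c m s : ℝ} {a : ℕ} (hc1 : c ≤ 1)
    (hm0 : 0 ≤ m) (hm : c * N ^ s ≤ m) (ha : m / 2 < a) : c / 2 * N ^ max s 0 ≤ a := by
  rcases le_total s 0 with h | h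
  · rw [max_eq_right h, Real.rpow_zero]
    have h1 : (0 : ℝ) < a := by linarith
    have h2 : (1 : ℝ) ≤ a := by exact_mod_cast Nat.cast_pos.1 h1
    linarith
  · rw [max_eq_left h]
    linarith

/-- The event is that each block has more than half of its expected number of weights above `n ^ β
i`. By independence of the blocks its probability is at least of order `n ^ hubExponent α β`, and on
it there are at least of order `n ^ copyExponent H α β` copies. -/
theorem exists_eventually_le_measureReal (hα : 1 < α) (hν : IsPowerLaw α ν)
    (hp : IsConnectionProbability ν p)
    (hG : ∀ n, IsInhomogeneousRandomGraph (P n) ν (p n) (W n) (G n)) {β : Fin k → ℝ}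
    (hβ : β ∈ strictFeasibleSet H α γ) :
    ∃ κ > 0, ∀ᶠ n : ℕ in atTop, κ * (n : ℝ) ^ hubExponent α β ≤
      (P n).real {ω | (n : ℝ) ^ γ < condCopyCount H (P n) (W n) (G n) ω} := by
  obtain ⟨d, _, hd, -, htail⟩ := hν.exists_tail_bounds (by linarith : 0 < α)
  obtain ⟨c, _, hc, -, hcp⟩ := hp.theta
  have hμ := hν.one_le_mean hα
  set μ := ∫ x, x ∂ν with hμdef
  have hμ0 : 0 < μ := by linarith
  obtain ⟨⟨hβ0, hβ1⟩, hβγ⟩ := hβ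
  -- The factor 2 covers the rounding in the block size `n / (k + 1)`.
  set c' : ℝ := min (d / (2 * (k + 1))) 1 with hc'
  have hc'0 : 0 < c' := by positivity
  have hc'1 : c' ≤ 1 := min_le_right _ _
  set A : ℝ := (c' / 2) ^ k * (c * μ⁻¹) ^ (orderedEdges H).card with hA
  have hA0 : 0 < A := by positivity
  set s : ℝ := copyExponent H α β - γ with hs
  have hs0 : 0 < s := sub_pos.2 hβγ
  refine ⟨(c' / 8) ^ k, by positivity, ?_⟩
  -- The gap `s > 0` beats all constants: `k ^ k` passes from labelled copies to subgraphs, and the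
  -- extra 1 makes the final inequality strict.
  filter_upwards [hcp, eventually_ge_atTop (2 * (k + 1)),
    eventually_le_natCast_rpow (((k : ℝ) ^ k + 1) / A) hs0] with n hpn hn hAn
  have hn1' : 1 ≤ n := by omega
  have hn1 : (1 : ℝ) ≤ n := by exact_mod_cast hn1'
  have hn0 : (0 : ℝ) < n := by linarith
  obtain ⟨b⟩ := exists_blocks k n
  set m : Fin k → ℝ := fun i => Fintype.card (Fin (n / (k + 1))) *
    ν.real (Set.Ici ((n : ℝ) ^ β i)) with hm
  have hdiv : (n : ℝ) / (2 * (k + 1)) ≤ ((n / (k + 1) : ℕ) : ℝ) := by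
    have h1 : n ≤ (n / (k + 1)) * (2 * (k + 1)) := by
      have h2 := Nat.div_add_mod n (k + 1)
      have h3 := Nat.mod_lt n (Nat.succ_pos k)
      have h4 : 1 ≤ n / (k + 1) := (Nat.one_le_div_iff (Nat.succ_pos k)).2 (by omega)
      nlinarith
    rw [div_le_iff₀ (by positivity)]
    exact_mod_cast h1
  have hm_lower : ∀ i, c' * (n : ℝ) ^ (1 - α * β i) ≤ m i := by
    intro i
    have hx := (htail ((n : ℝ) ^ β i) (Real.one_le_rpow hn1 (hβ0 i))).1
    calc c' * (n : ℝ) ^ (1 - α * β i) ≤ d / (2 * (k + 1)) * (n : ℝ) ^ (1 - α * β i) := by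
          gcongr
          exact min_le_left _ _
      _ = n / (2 * (k + 1)) * (d * ((n : ℝ) ^ β i) ^ (-α)) := by
          rw [← Real.rpow_mul hn0.le, sub_eq_add_neg, Real.rpow_add hn0, Real.rpow_one,
            show β i * -α = -(α * β i) by ring]
          ring
      _ ≤ m i := by
          simp only [hm, Fintype.card_fin]
          exact mul_le_mul hdiv hx (by positivity) (Nat.cast_nonneg _)
  have hm0 : ∀ i, 0 ≤ m i := fun i => mul_nonneg (Nat.cast_nonneg _) measureReal_nonneg
  have hsub : ∀ᵐ ω ∂P n, (∀ i, m i / 2 < exceedances ((n : ℝ) ^ β i) fun j => W n (b (i, j)) ω) →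
      (n : ℝ) ^ γ < condCopyCount H (P n) (W n) (G n) ω := by
    filter_upwards [(hG n).expectedLabelledCount_le H, (hG n).ae_one_le hν] with ω hle hW hω
    have h1 := le_expectedLabelledCount hn1' H hμ hc (w := fun i => W n i ω)
      (q := fun e => p n e fun i => W n i ω) (fun e => (hp.mem_unitInterval n e _ hW).1)
      (fun i j hij => (hpn _ hW i j hij).1) b β
    have h2 : ∏ i, (c' / 2 * (n : ℝ) ^ max (1 - α * β i) 0) ≤
        ∏ i, (exceedances ((n : ℝ) ^ β i) fun j => W n (b (i, j)) ω : ℝ) :=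
      Finset.prod_le_prod (fun i _ => by positivity) fun i _ =>
        const_mul_rpow_max_le hc'1 (hm0 i) (hm_lower i) (hω i)
    rw [Finset.prod_mul_distrib, Finset.prod_const, Finset.card_univ, Fintype.card_fin,
      ← Real.rpow_sum_of_pos hn0] at h2
    have h3 : A * (n : ℝ) ^ copyExponent H α β ≤
        (k : ℝ) ^ k * condCopyCount H (P n) (W n) (G n) ω := by
      refine le_trans ?_ (h1.trans hle)
      calc A * (n : ℝ) ^ copyExponent H α β
          = ((c' / 2) ^ k * (n : ℝ) ^ ∑ i, max (1 - α * β i) 0) *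
            ((c * μ⁻¹) ^ (orderedEdges H).card * (n : ℝ) ^ edgeExponent H β) := by
            rw [copyExponent, Real.rpow_add hn0, hA]
            ring
        _ ≤ _ := by gcongr
    have h4 : ((k : ℝ) ^ k + 1) * (n : ℝ) ^ γ ≤ A * (n : ℝ) ^ copyExponent H α β := by
      have h5 : (n : ℝ) ^ copyExponent H α β = (n : ℝ) ^ s * (n : ℝ) ^ γ := by
        rw [← Real.rpow_add hn0, hs]
        congr 1
        ring
      rw [div_le_iff₀ hA0] at hAn
      rw [h5, ← mul_assoc, mul_comm A]
      gcongr
    have hk0 : (0 : ℝ) ≤ (k : ℝ) ^ k := by positivity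
    have hγ0 : 0 < (n : ℝ) ^ γ := by positivity
    by_contra hcon
    have h6 := mul_le_mul_of_nonneg_left (not_lt.1 hcon) hk0
    linarith
  calc (c' / 8) ^ k * (n : ℝ) ^ hubExponent α β
      = ∏ i, (c' / 8 * (n : ℝ) ^ min (1 - α * β i) 0) := by
        rw [Finset.prod_mul_distrib, Finset.prod_const, Finset.card_univ, Fintype.card_fin,
          hubExponent, Real.rpow_sum_of_pos hn0]
    _ ≤ ∏ i, m i / (4 * (m i + 1)) := Finset.prod_le_prod (fun i _ => by positivity) fun i _ =>
        const_mul_rpow_min_le hn1 hc'0 hc'1 (hm_lower i)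
    _ ≤ (P n).real {ω | ∀ i, m i / 2 < exceedances ((n : ℝ) ^ β i)
          fun j => W n (b (i, j)) ω} :=
        prod_le_measureReal_lt_exceedances (X := fun a => W n (b a))
          (fun a => (hG n).measurable_weight _) (fun a => (hG n).law_weight _)
          ((hG n).indep_weight.precomp b.injective) _ m fun i => rfl
    _ ≤ (P n).real {ω | (n : ℝ) ^ γ < condCopyCount H (P n) (W n) (G n) ω} :=
        ENNReal.toReal_mono (measure_ne_top _ _) (measure_mono_ae hsub)

end

/-- A sequence squeezed between powers of `n` with exponents close to `ρ` has logarithmic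
growth rate `ρ`. -/
theorem tendsto_log_div_log {u : ℕ → ℝ} {ρ : ℝ}
    (hupper : ∀ ε : ℝ, 0 < ε → ∀ᶠ n : ℕ in atTop, u n ≤ (n : ℝ) ^ (ρ + ε))
    (hlower : ∀ ε : ℝ, 0 < ε → ∀ᶠ n : ℕ in atTop, (n : ℝ) ^ (ρ - ε) ≤ u n) :
    Tendsto (fun n : ℕ => Real.log (u n) / Real.log n) atTop (𝓝 ρ) := by
  rw [Metric.tendsto_nhds]
  intro ε hε
  filter_upwards [hupper (ε / 2) (half_pos hε), hlower (ε / 2) (half_pos hε),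
    eventually_ge_atTop 2] with n h1 h2 hn
  have hn1 : (1 : ℝ) < n := by exact_mod_cast hn
  have hn0 : (0 : ℝ) < n := by linarith
  have hlog : 0 < Real.log n := Real.log_pos hn1
  have hpos : 0 < (n : ℝ) ^ (ρ - ε / 2) := by positivity
  have h3 := Real.log_le_log (hpos.trans_le h2) h1
  have h4 := Real.log_le_log hpos h2
  rw [Real.log_rpow hn0] at h3 h4
  have h5 := (div_le_iff₀ hlog).2 h3
  have h6 := (le_div_iff₀ hlog).2 h4
  rw [Real.dist_eq, abs_lt]
  constructor <;> linarith

end SubgraphDeviation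

theorem mainTheorem2 {k : ℕ} (H : SimpleGraph (Fin k)) (α γ : ℝ) (hα₁ : 1 < α) (hα₂ : α < 2)
    (hH : SubgraphDeviation.OptimizerHasNoHubs H α) (hγ : k * (2 - α) / 2 < γ)
    (hfeas : (SubgraphDeviation.feasibleSet H α γ).Nonempty)
    (ν : Measure ℝ) (hν : SubgraphDeviation.IsPowerLaw α ν)
    (p : ∀ n : ℕ, Sym2 (Fin n) → (Fin n → ℝ) → ℝ)
    (hp : SubgraphDeviation.IsConnectionProbability ν p)
    {Ω : ℕ → Type*} [∀ n, MeasurableSpace (Ω n)]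
    (P : ∀ n, Measure (Ω n)) [∀ n, IsProbabilityMeasure (P n)]
    (W : ∀ n, Fin n → Ω n → ℝ) (G : ∀ n, Ω n → SimpleGraph (Fin n))
    (hG : ∀ n, SubgraphDeviation.IsInhomogeneousRandomGraph (P n) ν (p n) (W n) (G n)) :
    (∀ ε : ℝ, 0 < ε → ∀ᶠ n : ℕ in atTop,
      (P n).real {ω | (n : ℝ) ^ γ < SubgraphDeviation.condCopyCount H (P n) (W n) (G n) ω} ≤
        (n : ℝ) ^ (SubgraphDeviation.rate H α γ + ε)) ∧
    ((∀ ε : ℝ, 0 < ε → ∃ β ∈ SubgraphDeviation.strictFeasibleSet H α γ,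
        SubgraphDeviation.rate H α γ - ε < SubgraphDeviation.hubExponent α β) →
      (∀ᶠ n : ℕ in atTop,
        0 < (P n).real
          {ω | (n : ℝ) ^ γ < SubgraphDeviation.condCopyCount H (P n) (W n) (G n) ω}) ∧
      Tendsto (fun n : ℕ =>
        Real.log ((P n).real
          {ω | (n : ℝ) ^ γ < SubgraphDeviation.condCopyCount H (P n) (W n) (G n) ω}) / Real.log n)
        atTop (𝓝 (SubgraphDeviation.rate H α γ))) := by
  refine ⟨fun ε hε => SubgraphDeviation.eventually_measureReal_le H hα₁ hfeas hν hp hG hε,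
    fun hstrict => ?_⟩
  have hlower : ∀ ε : ℝ, 0 < ε → ∀ᶠ n : ℕ in atTop,
      (n : ℝ) ^ (SubgraphDeviation.rate H α γ - ε) ≤ (P n).real
        {ω | (n : ℝ) ^ γ < SubgraphDeviation.condCopyCount H (P n) (W n) (G n) ω} := by
    intro ε hε
    -- Half of `ε` is spent on near-optimality of `β`, the other half on the constant `κ`.
    obtain ⟨β, hβ, hβε⟩ := hstrict (ε / 2) (half_pos hε)
    obtain ⟨κ, hκ, hev⟩ :=
      SubgraphDeviation.exists_eventually_le_measureReal H hα₁ hν hp hG hβ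
    filter_upwards [hev, eventually_ge_atTop 1,
      SubgraphDeviation.eventually_le_natCast_rpow κ⁻¹ (half_pos hε)] with n h1 hn h2
    have hn1 : (1 : ℝ) ≤ n := by exact_mod_cast hn
    have hn0 : (0 : ℝ) < n := by linarith
    refine le_trans ?_ h1
    rw [inv_le_iff_one_le_mul₀' hκ] at h2
    calc (n : ℝ) ^ (SubgraphDeviation.rate H α γ - ε)
        ≤ κ * (n : ℝ) ^ (ε / 2) * (n : ℝ) ^ (SubgraphDeviation.rate H α γ - ε) :=
          le_mul_of_one_le_left (by positivity) h2
      _ = κ * (n : ℝ) ^ (SubgraphDeviation.rate H α γ - ε / 2) := by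
          rw [mul_assoc, ← Real.rpow_add hn0]
          congr 2
          ring
      _ ≤ κ * (n : ℝ) ^ SubgraphDeviation.hubExponent α β := by gcongr
  refine ⟨?_, SubgraphDeviation.tendsto_log_div_log
    (fun ε hε => SubgraphDeviation.eventually_measureReal_le H hα₁ hfeas hν hp hG hε) hlower⟩
  -- Positivity is taken from the lower bound, here with `ε = 1`; since `Real.log 0 = 0`, the
  -- logarithmic limit alone need not imply it.
  filter_upwards [hlower 1 one_pos, eventually_ge_atTop 1] with n h1 hn
  have hn0 : (0 : ℝ) < n := by exact_mod_cast hn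
  exact (Real.rpow_pos_of_pos hn0 _).trans_le h1
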